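/- Let $V$ and $V'$ be left vector spaces of finite dimensions $n$ and $n'$ over division rings $R$ and $R'$. For $0\le k\le n$ let $\mathcal G_k(V)$ be the set of $k$-dimensional subspaces of $V$, and let the Grassmann graph $\Gamma_k(V)$ be the graph with vertex set $\mathcal G_k(V)$ in which $X,Y$ are adjacent if and only if $\dim(X\cap Y)=k-1$. An isometric embedding of a graph $\Gamma$ in a graph $\Gamma'$ is an injective map of vertices that preserves adjacency and non-adjacency, and preserves the graph distance between any two vertices. A map $l$ from a left vector space over $R$ to a left vector space over a division ring $Q$ is semilinear if it is additive and there is a ring homomorphism $\sigma:R\to Q$ with $l(ax)=\sigma(a)l(x)$ for all $a,x$. An injective semilinear map is a semilinear $m$-embedding if it sends every linearly independent $m$-element subset to a linearly independent subset. A semilinear embedding of $V$ in $W$, where $n\le\dim W$, is a semilinear $n$-embedding. For a left vector space $W$ over $R'$, the dual $W^*$ is regarded as a left vector space over the opposite division ring of $R'$, and for a subspace $\Phi\subset W^*$ we put $\Phi^{0}=\{w\in W:\varphi(w)=0 \text{ for all }\varphi\in\Phi\}$. For subspaces $S\subset U$ of $V'$ and a subspace $Y\subset U/S$, let $\pi(Y)\subset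 U\subset V'$ be the preimage of $Y$ under the quotient map $U\to U/S$ (with $U=V'$ in the case of $V'/S$). **Theorem 4.1.** Let $1<k<n-1$, $1<k'<n'-1$ and $k\le n-k$, and let $f$ be an isometric embedding of $\Gamma_k(V)$ in $\Gamma_{k'}(V')$. Then at least one of the following holds: (A) $k\le k'$, and there are a $(k'-k)$-dimensional subspace $S\subset V'$ and a semilinear $(2k)$-embedding $l:V\to V'/S$ such that $f(X)=\pi(\langle l(X)\rangle)$ for all $X\in\mathcal G_k(V)$; (B) there are a $(k'+k)$-dimensional subspace $U\subset V'$ and a semilinear $(2k)$-embedding $l:V\to U^*$ such that $f(X)=\langle l(X)\rangle^{0}\subset U\subset V'$ for all $X\in\mathcal G_k(V)$. If moreover $n=2k$, then $k\le k'$ and there are subspaces $S\subset U\subset V'$ with $\dim S=k'-k$ and $\dim U=k'+k$ such that there is a semilinear embedding $l:V\to U/S$ with $f(X)=\pi(\langle l(X)\rangle)$ for all $X\in\mathcal G_k(V)$, or there is a semilinear embedding $l:V\to (U/S)^*$ with $f(X)=\pi(\langle l(X)\rangle^{0})$ for all $X\in\mathcal G_k(V)$. -/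

import Mathlib

namespace GrassmannEmb

/-- The Grassmannian of the `k`-dimensional subspaces of `V`. -/
abbrev Grass (R V : Type*) [DivisionRing R] [AddCommGroup V] [Module R V] (k : ℕ) :=
  {X : Submodule R V // Module.finrank R X = k}

/-- The Grassmann graph: two `k`-dimensional subspaces are adjacent
when their intersection is `(k-1)`-dimensional. -/
def grassmannGraph (R V : Type*) [DivisionRing R] [AddCommGroup V] [Module R V] (k : ℕ) :
    SimpleGraph (Grass R V k) where
  Adj X Y := Module.finrank R ↥(X.1 ⊓ Y.1) + 1 = k
  symm := ⟨fun X Y h => by rwa [inf_comm]⟩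
  loopless := ⟨fun X h => by
    have hX := X.2
    rw [inf_idem] at h
    omega⟩

/-- A semilinear `m`-embedding: a semilinear injection that sends every independent `m`-element
subset (written as an independent family indexed by `Fin m`) to an independent one. -/
def IsSemilinearMEmbedding {R R' V W : Type*} [DivisionRing R] [DivisionRing R']
    [AddCommGroup V] [Module R V] [AddCommGroup W] [Module R' W] {σ : R →+* R'}
    (m : ℕ) (l : V →ₛₗ[σ] W) : Prop :=
  Function.Injective l ∧
    ∀ v : Fin m → V, LinearIndependent R v → LinearIndependent R' (fun i => l (v i))

/-- A semilinear embedding: a semilinear `n`-embedding, where `n = dim V` and `n ≤ dim W`. -/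
def IsSemilinearEmbedding {R R' V W : Type*} [DivisionRing R] [DivisionRing R']
    [AddCommGroup V] [Module R V] [AddCommGroup W] [Module R' W] {σ : R →+* R'}
    (l : V →ₛₗ[σ] W) : Prop :=
  Module.finrank R V ≤ Module.finrank R' W ∧ IsSemilinearMEmbedding (Module.finrank R V) l

/-- The subspace `⟨l(X)⟩` spanned by the image of the subspace `X` under a semilinear map. -/
def spanImage {R R' V W : Type*} [DivisionRing R] [DivisionRing R']
    [AddCommGroup V] [Module R V] [AddCommGroup W] [Module R' W] {σ : R →+* R'}
    (l : V →ₛₗ[σ] W) (X : Submodule R V) : Submodule R' W :=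
  Submodule.span R' (l '' (X : Set V))

/-- The annihilator in `W` of a subspace of the dual space `W*`. The dual of a left vector space
over `R` is a right vector space over `R`, that is, a left vector space over `Rᵐᵒᵖ`. -/
def annihilator {R W : Type*} [DivisionRing R] [AddCommGroup W] [Module R W]
    (Φ : Submodule Rᵐᵒᵖ (Module.Dual R W)) : Submodule R W where
  carrier := {x | ∀ φ ∈ Φ, φ x = 0}
  add_mem' := by
    intro a b ha hb φ hφ
    rw [map_add, ha φ hφ, hb φ hφ, add_zero]
  zero_mem' := fun φ _ => map_zero φ
  smul_mem' := by
    intro c x hx φ hφ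
    rw [map_smul, hx φ hφ, smul_zero]

/-- The quotient space `U/S` (used for `S ≤ U`). -/
abbrev Subquot {R W : Type*} [DivisionRing R] [AddCommGroup W] [Module R W]
    (S U : Submodule R W) :=
  ↥U ⧸ S.submoduleOf U

/-- The subspace of `W`, between `S` and `U`, that corresponds to a subspace of `U/S`. -/
def liftSubquot {R W : Type*} [DivisionRing R] [AddCommGroup W] [Module R W]
    (S U : Submodule R W) (Y : Submodule R (Subquot S U)) : Submodule R W :=
  (Y.comap (S.submoduleOf U).mkQ).map U.subtype

end GrassmannEmb

/-!
An isometric map `f` of Grassmann graphs satisfies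
`dim (f X ⊓ f Y) = (k' - k) + dim (X ⊓ Y)`, because the distance of two vertices `X`, `Y` is
`k - dim (X ⊓ Y)` (`finrank_inf_add_dist`). From here on only this identity matters, and the
target is treated as a lattice with a modular rank function (`IsRank`): either the lattice of
subspaces of `V'` or its order dual. Below, `r₀` is `k' - k` in the former and `n' - k' - k` in the
latter. The second case of the theorem is the first one in the dual
lattice.

A star is the set of `k`-dimensional subspaces through one of dimension `k - 1`, a top the set of
those below one of dimension `k + 1`. Stars and tops are cliques, and every clique of the target
lies in a star or in a top (`IsRank.clique_le_or_le`). An incident star and top share two adjacent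
vertices but also contain two vertices at distance two, so `f` cannot send both into stars, or both
into tops; by connectedness either all stars go into stars or all stars go into tops
(`forall_isStarAt_or_forall_isTopAt`). After dualizing, all stars go into stars.

The centres of the image stars then define a map on `(k - 1)`-dimensional subspaces with the same
two properties (`IsStarIsometry.descend`): the defect of the intersection is found by squeezing it
between extensions with smallest and largest intersection, for which `2 * k ≤ dim V` leaves enough
room. Repeating this leads to a map `g` on points, with values above one element `s` of rank
`r₀`, such that `f X` is the join of the `g P` for `P ≤ X`. This map sends collinear points to
collinear points and noncollinear points to noncollinear points (`IsPointMap.le_sup`,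
`IsPointMap.not_le_sup`), since disjoint subspaces of dimension `k` have images meeting in rank
`r₀` only.

Such a map is induced by a semilinear map even if it is not surjective
(`IsCollineation.exists_semilinear`): on a hyperplane not containing `x₀`, representatives are
normalized by requiring that `x₀ + x` goes to the sum of the images of `x₀` and `x`, and additivity
follows by intersecting lines. The independence of the images of `2 * k` independent vectors is a
rank count for two complementary `k`-dimensional subspaces of their span
(`IsPointMap.exists_semilinear`). The four conclusions of the theorem arise from four ways of
writing part of the target lattice as the lattice of subspaces of a vector space: above `S`, below
`U` through annihilators in the dual of `U`, and, for `dim V = 2 * k`, where the images of all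
points have a common upper bound of rank `r₀ + 2 * k`, the corresponding intervals.
-/

namespace GrassmannEmb

open Module

/-! ### Subspaces of prescribed dimension -/

section Subspaces

variable {R V : Type*} [DivisionRing R] [AddCommGroup V] [Module R V]

theorem sup_span_singleton_le {A C : Submodule R V} {x : V} (hA : A ≤ C) (hx : x ∈ C) :
    A ⊔ R ∙ x ≤ C :=
  sup_le hA ((Submodule.span_singleton_le_iff_mem x C).2 hx)

theorem mem_sup_span_singleton (A : Submodule R V) (x : V) : x ∈ A ⊔ R ∙ x :=
  (le_sup_right : R ∙ x ≤ A ⊔ R ∙ x) (Submodule.mem_span_singleton_self x)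

variable [FiniteDimensional R V]

theorem finrank_sup_span_singleton {A : Submodule R V} {x : V} (hx : x ∉ A) :
    finrank R ↥(A ⊔ R ∙ x) = finrank R A + 1 := by
  have hx0 : x ≠ 0 := fun h => hx (h ▸ A.zero_mem)
  have h := Submodule.finrank_sup_add_finrank_inf_eq A (R ∙ x)
  have hbot : A ⊓ (R ∙ x) = ⊥ := by
    rw [← disjoint_iff]
    exact (Submodule.disjoint_span_singleton' hx0).2 hx
  rw [hbot, finrank_bot, finrank_span_singleton hx0] at h
  exact h

theorem exists_mem_notMem_of_finrank_lt {A B : Submodule R V} (h : finrank R A < finrank R B) :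
    ∃ x ∈ B, x ∉ A := by
  by_contra! hc
  exact absurd (Submodule.finrank_mono (show B ≤ A from hc)) (by omega)

theorem exists_finrank_eq_between {A B : Submodule R V} (hAB : A ≤ B) {m : ℕ}
    (hm : finrank R A ≤ m) (hm' : m ≤ finrank R B) :
    ∃ C, A ≤ C ∧ C ≤ B ∧ finrank R C = m := by
  induction m, hm using Nat.le_induction with
  | base => exact ⟨A, le_rfl, hAB, rfl⟩
  | succ m _ ih =>
    obtain ⟨C, hAC, hCB, hC⟩ := ih (by omega)
    obtain ⟨x, hxB, hxC⟩ := exists_mem_notMem_of_finrank_lt (A := C) (B := B) (by omega)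
    exact ⟨C ⊔ R ∙ x, hAC.trans le_sup_left, sup_span_singleton_le hCB hxB,
      by rw [finrank_sup_span_singleton hxC, hC]⟩

/-- A vector outside `A ⊔ B` enlarges `A` without enlarging its intersection with `B`. -/
theorem sup_span_singleton_inf {A B : Submodule R V} {x : V} (hx : x ∉ A ⊔ B) :
    (A ⊔ R ∙ x) ⊓ B = A ⊓ B := by
  refine (Submodule.eq_of_le_of_finrank_eq (inf_le_inf_right B le_sup_left) ?_).symm
  have h1 := Submodule.finrank_sup_add_finrank_inf_eq A B
  have h2 := Submodule.finrank_sup_add_finrank_inf_eq (A ⊔ R ∙ x) B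
  have hxA : x ∉ A := fun h => hx ((le_sup_left : A ≤ A ⊔ B) h)
  rw [show A ⊔ (R ∙ x) ⊔ B = (A ⊔ B) ⊔ R ∙ x by ac_rfl, finrank_sup_span_singleton hx,
    finrank_sup_span_singleton hxA] at h2
  omega

/-- One-sided form of `exists_extensions`. -/
theorem exists_extension_left {A B : Submodule R V} {a : ℕ} (ha : finrank R A ≤ a)
    (hab : a + finrank R B ≤ finrank R V) :
    ∃ X, A ≤ X ∧ finrank R X = a ∧ X ⊓ B = A ⊓ B := by
  induction a, ha using Nat.le_induction with
  | base => exact ⟨A, le_rfl, rfl, rfl⟩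
  | succ a _ ih =>
    obtain ⟨X, hAX, hX, hXB⟩ := ih (by omega)
    have h := Submodule.finrank_add_le_finrank_add_finrank X B
    obtain ⟨x, -, hx⟩ := exists_mem_notMem_of_finrank_lt (A := X ⊔ B) (B := ⊤)
      (by rw [finrank_top]; omega)
    have hxX : x ∉ X := fun h => hx ((le_sup_left : X ≤ X ⊔ B) h)
    exact ⟨X ⊔ R ∙ x, hAX.trans le_sup_left, by rw [finrank_sup_span_singleton hxX, hX],
      by rw [sup_span_singleton_inf hx, hXB]⟩

/-- Two subspaces can be enlarged to given dimensions, of sum at most `dim V`,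
without enlarging their intersection. -/
theorem exists_extensions {A B : Submodule R V} {a b : ℕ} (ha : finrank R A ≤ a)
    (hb : finrank R B ≤ b) (hab : a + b ≤ finrank R V) :
    ∃ X Y, A ≤ X ∧ B ≤ Y ∧ finrank R X = a ∧ finrank R Y = b ∧ X ⊓ Y = A ⊓ B := by
  obtain ⟨X, hAX, hX, hXB⟩ := exists_extension_left (A := A) (B := B) ha (by omega)
  obtain ⟨Y, hBY, hY, hYX⟩ := exists_extension_left (A := B) (B := X) hb (by omega)
  exact ⟨X, Y, hAX, hBY, hX, hY, by rw [inf_comm, hYX, inf_comm, hXB]⟩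

theorem finrank_inf_lt_of_ne {A B : Submodule R V} (h : finrank R A = finrank R B) (hne : A ≠ B) :
    finrank R ↥(A ⊓ B) < finrank R A := by
  refine Submodule.finrank_lt_finrank_of_lt (lt_of_le_of_ne inf_le_left fun he => hne ?_)
  exact Submodule.eq_of_le_of_finrank_eq (inf_eq_left.1 he) h

end Subspaces

/-! ### Distances in the Grassmann graph -/

section Distance

variable {R V : Type*} [DivisionRing R] [AddCommGroup V] [Module R V] [FiniteDimensional R V]
  {k : ℕ}

theorem le_finrank_inf_add_length {X Y : Grass R V k} (p : (grassmannGraph R V k).Walk X Y) :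
    k ≤ finrank R ↥(X.1 ⊓ Y.1) + p.length := by
  induction p with
  | @nil X => rw [inf_idem, X.2]; exact Nat.le_add_right _ _
  | @cons X Z Y h p ih =>
    have hadj : finrank R ↥(X.1 ⊓ Z.1) + 1 = k := h
    have h1 := Submodule.finrank_sup_add_finrank_inf_eq (X.1 ⊓ Z.1) (Z.1 ⊓ Y.1)
    have h2 : finrank R ↥(X.1 ⊓ Z.1 ⊔ Z.1 ⊓ Y.1) ≤ finrank R Z.1 :=
      Submodule.finrank_mono (sup_le inf_le_right inf_le_left)
    have h3 : finrank R ↥(X.1 ⊓ Z.1 ⊓ (Z.1 ⊓ Y.1)) ≤ finrank R ↥(X.1 ⊓ Y.1) :=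
      Submodule.finrank_mono (inf_le_inf inf_le_left inf_le_right)
    have h4 := Z.2
    rw [SimpleGraph.Walk.length_cons]
    omega

theorem exists_walk_length_eq (d : ℕ) (X Y : Grass R V k)
    (h : finrank R ↥(X.1 ⊓ Y.1) + d = k) :
    ∃ p : (grassmannGraph R V k).Walk X Y, p.length = d := by
  induction d generalizing X with
  | zero =>
    have hX := X.2
    have hY := Y.2
    have h1 : X.1 ⊓ Y.1 = X.1 := Submodule.eq_of_le_of_finrank_eq inf_le_left (by omega)
    have h2 : X = Y := Subtype.ext (Submodule.eq_of_le_of_finrank_eq (inf_eq_left.1 h1) (by omega))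
    subst h2
    exact ⟨.nil, rfl⟩
  | succ d ih =>
    -- A neighbour of `X` one step closer to `Y`: a hyperplane of `X` through `X ⊓ Y`
    -- together with a vector of `Y` outside `X`.
    have hX := X.2
    have hY := Y.2
    obtain ⟨A, hA, hAX, hAd⟩ := exists_finrank_eq_between
      (inf_le_left : X.1 ⊓ Y.1 ≤ X.1) (m := k - 1) (by omega) (by omega)
    obtain ⟨y, hyY, hyX'⟩ := exists_mem_notMem_of_finrank_lt (A := X.1 ⊓ Y.1) (B := Y.1) (by omega)
    have hyX : y ∉ X.1 := fun h => hyX' ⟨h, hyY⟩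
    have hyA : y ∉ A := fun h => hyX (hAX h)
    have hZd : finrank R ↥(A ⊔ R ∙ y) = k := by rw [finrank_sup_span_singleton hyA]; omega
    let Z : Grass R V k := ⟨A ⊔ R ∙ y, hZd⟩
    have hZX : (A ⊔ R ∙ y) ⊓ X.1 = A := by
      rw [sup_span_singleton_inf (by rwa [sup_eq_right.2 hAX]), inf_eq_left.2 hAX]
    have hZY : (X.1 ⊓ Y.1) ⊔ R ∙ y ≤ Z.1 ⊓ Y.1 :=
      le_inf (sup_le_sup_right hA _) (sup_span_singleton_le inf_le_right hyY)
    have h1 := Submodule.finrank_mono hZY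
    rw [finrank_sup_span_singleton hyX'] at h1
    have hadj : (grassmannGraph R V k).Adj X Z := by
      change finrank R ↥(X.1 ⊓ (A ⊔ R ∙ y)) + 1 = k
      rw [inf_comm, hZX]; omega
    -- The intersection cannot grow by more than one dimension.
    have h2 : finrank R ↥(Z.1 ⊓ Y.1) + d = k := by
      have h3 := Submodule.finrank_sup_add_finrank_inf_eq (Z.1 ⊓ Y.1) A
      have h4 : finrank R ↥(Z.1 ⊓ Y.1 ⊔ A) ≤ k :=
        (Submodule.finrank_mono (sup_le inf_le_left le_sup_left)).trans hZd.le
      have h5 : finrank R ↥(Z.1 ⊓ Y.1 ⊓ A) ≤ finrank R ↥(X.1 ⊓ Y.1) :=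
        Submodule.finrank_mono (le_inf (inf_le_right.trans hAX) (inf_le_left.trans inf_le_right))
      omega
    obtain ⟨p, hp⟩ := ih Z h2
    exact ⟨.cons hadj p, by rw [SimpleGraph.Walk.length_cons, hp]⟩

theorem grassmannGraph_preconnected : (grassmannGraph R V k).Preconnected := fun X Y => by
  have h := Submodule.finrank_mono (inf_le_left : X.1 ⊓ Y.1 ≤ X.1)
  rw [X.2] at h
  obtain ⟨p, -⟩ := exists_walk_length_eq (k - finrank R ↥(X.1 ⊓ Y.1)) X Y (by omega)
  exact ⟨p⟩

/-- The distance of `X` and `Y` in the Grassmann graph is `k - dim (X ⊓ Y)`. -/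
theorem finrank_inf_add_dist (X Y : Grass R V k) :
    finrank R ↥(X.1 ⊓ Y.1) + (grassmannGraph R V k).dist X Y = k := by
  have h := Submodule.finrank_mono (inf_le_left : X.1 ⊓ Y.1 ≤ X.1)
  rw [X.2] at h
  obtain ⟨p, hp⟩ := exists_walk_length_eq (k - finrank R ↥(X.1 ⊓ Y.1)) X Y (by omega)
  obtain ⟨q, hq⟩ := (grassmannGraph_preconnected X Y).exists_walk_length_eq_dist
  have h1 := le_finrank_inf_add_length q
  have h2 := SimpleGraph.dist_le p
  omega

end Distance

/-! ### Cliques in ranked modular lattices -/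

section Lattice

variable {L : Type*} [Lattice L]

/-- A rank function on a lattice: strictly monotone and satisfying the modular law. -/
structure IsRank (r : L → ℕ) : Prop where
  strictMono : StrictMono r
  sup_add_inf : ∀ a b, r (a ⊔ b) + r (a ⊓ b) = r a + r b

namespace IsRank

variable {r : L → ℕ}

theorem mono (hr : IsRank r) {a b : L} (h : a ≤ b) : r a ≤ r b :=
  hr.strictMono.monotone h

theorem eq_of_le (hr : IsRank r) {a b : L} (h : a ≤ b) (hab : r b ≤ r a) : a = b :=
  h.eq_of_not_lt fun hlt => absurd (hr.strictMono hlt) hab.not_gt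

theorem le_sup_of_not_inf_le (hr : IsRank r) {a b c : L} {m : ℕ} (hc : r c = m + 1)
    (hab : r (a ⊓ b) = m) (hac : r (a ⊓ c) = m) (hbc : r (b ⊓ c) = m) (h : ¬ a ⊓ b ≤ c) :
    c ≤ a ⊔ b := by
  have hne : a ⊓ c ≠ b ⊓ c := fun he => h <| by
    have h1 : a ⊓ c = a ⊓ b := hr.eq_of_le (le_inf inf_le_left (he.le.trans inf_le_left))
      (by omega)
    exact h1 ▸ inf_le_right
  have h1 : r (a ⊓ c) < r (a ⊓ c ⊔ b ⊓ c) := by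
    refine hr.strictMono (lt_of_le_of_ne le_sup_left fun he => hne ?_)
    exact (hr.eq_of_le (sup_eq_left.1 he.symm) (by omega)).symm
  have h2 : a ⊓ c ⊔ b ⊓ c = c := hr.eq_of_le (sup_le inf_le_right inf_le_right) (by omega)
  rw [← h2]
  exact sup_le_sup inf_le_left inf_le_left

/-- A clique of the Grassmann graph of a ranked lattice, containing `a ≠ b`, lies above
`a ⊓ b` or below `a ⊔ b`. -/
theorem clique_le_or_le (hr : IsRank r) {K : Set L} {m : ℕ} (hK : ∀ x ∈ K, r x = m + 1)
    (hadj : ∀ x ∈ K, ∀ y ∈ K, x ≠ y → r (x ⊓ y) = m) {a b : L} (ha : a ∈ K) (hb : b ∈ K)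
    (hab : a ≠ b) : (∀ z ∈ K, a ⊓ b ≤ z) ∨ ∀ z ∈ K, z ≤ a ⊔ b := by
  by_contra! hcon
  obtain ⟨⟨z, hz, hzab⟩, w, hw, hwab⟩ := hcon
  have hza : z ≠ a := fun h => hzab (h ▸ inf_le_left)
  have hzb : z ≠ b := fun h => hzab (h ▸ inf_le_right)
  have hwa : w ≠ a := fun h => hwab (h ▸ le_sup_left)
  have hwb : w ≠ b := fun h => hwab (h ▸ le_sup_right)
  have hz' : z ≤ a ⊔ b := hr.le_sup_of_not_inf_le (hK z hz) (hadj a ha b hb hab)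
    (hadj a ha z hz hza.symm) (hadj b hb z hz hzb.symm) hzab
  have hwz : w ≠ z := fun h => hwab (h ▸ hz')
  have h1 : a ⊓ b ≤ w := by
    by_contra h
    exact hwab (hr.le_sup_of_not_inf_le (hK w hw) (hadj a ha b hb hab)
      (hadj a ha w hw hwa.symm) (hadj b hb w hw hwb.symm) h)
  have h2 : a ⊓ z ≤ w := by
    by_contra h
    exact hwab ((hr.le_sup_of_not_inf_le (hK w hw) (hadj a ha z hz hza.symm)
      (hadj a ha w hw hwa.symm) (hadj z hz w hw hwz.symm) h).trans (sup_le le_sup_left hz'))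
  -- Now `w` lies above `(a ⊓ b) ⊔ (a ⊓ z) = a`.
  have h3 : a ⊓ b ⊔ a ⊓ z ≤ a := sup_le inf_le_left inf_le_left
  have h4 : r (a ⊓ b) < r (a ⊓ b ⊔ a ⊓ z) := by
    refine hr.strictMono (lt_of_le_of_ne le_sup_left fun he => hzab ?_)
    have h5 : a ⊓ z ≤ a ⊓ b := sup_eq_left.1 he.symm
    have h6 := hr.eq_of_le h5 (by rw [hadj a ha b hb hab, hadj a ha z hz hza.symm])
    exact h6 ▸ inf_le_right
  have h5 := hadj a ha b hb hab
  have h6 := hr.eq_of_le h3 (by have := hK a ha; omega)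
  have h7 : a ≤ w := h6 ▸ sup_le h1 h2
  exact hwa (hr.eq_of_le h7 (by rw [hK a ha, hK w hw])).symm

end IsRank

end Lattice

/-! ### Maps that preserve distances between subspaces of a given dimension -/

section Level

variable {R V : Type*} [DivisionRing R] [AddCommGroup V] [Module R V]
  {L : Type*} [Lattice L] {r : L → ℕ} {r₀ k : ℕ} {f : Submodule R V → L}

/-- `f` maps the `k`-dimensional subspaces to elements of rank `r₀ + k`, preserving the defect of
intersections. The values of `f` on subspaces of other dimensions are irrelevant. -/
def IsIsometricAt (r : L → ℕ) (r₀ k : ℕ) (f : Submodule R V → L) : Prop :=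
  ∀ A B : Submodule R V, finrank R A = k → finrank R B = k →
    r (f A ⊓ f B) = r₀ + finrank R ↥(A ⊓ B)

/-- The images of the `k`-dimensional subspaces through `C`, of dimension `k - 1`, have a common
lower bound of rank `r₀ + k - 1`. -/
def IsStarAt (r : L → ℕ) (r₀ k : ℕ) (f : Submodule R V → L) (C : Submodule R V) : Prop :=
  ∃ c, r c + 1 = r₀ + k ∧ ∀ A, C ≤ A → finrank R A = k → c ≤ f A

/-- The images of the `k`-dimensional subspaces through `C`, of dimension `k - 1`, have a common
upper bound of rank `r₀ + k + 1`. -/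
def IsTopAt (r : L → ℕ) (r₀ k : ℕ) (f : Submodule R V → L) (C : Submodule R V) : Prop :=
  ∃ c, r c = r₀ + k + 1 ∧ ∀ A, C ≤ A → finrank R A = k → f A ≤ c

/-- An isometric map sending every star of `k`-dimensional subspaces into a star. -/
structure IsStarIsometry (r : L → ℕ) (r₀ k : ℕ) (f : Submodule R V → L) : Prop where
  isometric : IsIsometricAt r r₀ k f
  star : ∀ C : Submodule R V, finrank R C + 1 = k → IsStarAt r r₀ k f C

theorem IsIsometricAt.rank_eq (hf : IsIsometricAt r r₀ k f) {A : Submodule R V}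
    (hA : finrank R A = k) : r (f A) = r₀ + k := by
  have h := hf A A hA hA
  rwa [inf_idem, inf_idem, hA] at h

theorem IsIsometricAt.ne (hf : IsIsometricAt r r₀ k f) [FiniteDimensional R V]
    {A B : Submodule R V} (hA : finrank R A = k) (hB : finrank R B = k) (hAB : A ≠ B) :
    f A ≠ f B := fun h => by
  have h1 := hf A B hA hB
  rw [← h, inf_idem, hf.rank_eq hA] at h1
  have := finrank_inf_lt_of_ne (hA.trans hB.symm) hAB
  omega

variable [FiniteDimensional R V]

/-- For `A ≤ U`, the star of `A` and the top of `U` share two distinct elements `X`, `Y`, while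
some `Z` in the star and some `Z'` in the top are at distance at least two. -/
theorem exists_adjacent_and_distant {A U : Submodule R V} (hAU : A ≤ U)
    (hA : finrank R A + 1 = k) (hU : finrank R U = k + 1) (hk : 2 ≤ k)
    (hn : k + 2 ≤ finrank R V) :
    ∃ X Y Z Z' : Submodule R V, finrank R X = k ∧ finrank R Y = k ∧ finrank R Z = k ∧
      finrank R Z' = k ∧ X ≠ Y ∧ A ≤ X ∧ A ≤ Y ∧ A ≤ Z ∧ X ≤ U ∧ Y ≤ U ∧ Z' ≤ U ∧
      finrank R ↥(Z ⊓ Z') + 2 ≤ k := by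
  obtain ⟨x, hxU, hxA⟩ := exists_mem_notMem_of_finrank_lt (A := A) (B := U) (by omega)
  have hX := finrank_sup_span_singleton hxA
  obtain ⟨y, hyU, hyX⟩ := exists_mem_notMem_of_finrank_lt (A := A ⊔ R ∙ x) (B := U) (by omega)
  have hyA : y ∉ A := fun h => hyX ((le_sup_left : A ≤ A ⊔ R ∙ x) h)
  have hY := finrank_sup_span_singleton hyA
  obtain ⟨z, -, hzU⟩ := exists_mem_notMem_of_finrank_lt (A := U) (B := ⊤)
    (by rw [finrank_top]; omega)
  have hzA : z ∉ A := fun h => hzU (hAU h)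
  have hZ := finrank_sup_span_singleton hzA
  -- `Z'` is a hyperplane of `U` avoiding a nonzero vector `a` of `A`.
  obtain ⟨a, haA, ha⟩ := exists_mem_notMem_of_finrank_lt (A := (⊥ : Submodule R V)) (B := A)
    (by rw [finrank_bot]; omega)
  have ha0 : a ≠ 0 := fun h => ha (h ▸ Submodule.zero_mem _)
  obtain ⟨W, hW⟩ := exists_isCompl (R ∙ a)
  have haW : a ∉ W := fun h => ha0 <| by
    have := hW.disjoint.le_bot ⟨Submodule.mem_span_singleton_self a, h⟩
    simpa using this
  have hWd := Submodule.finrank_add_eq_of_isCompl hW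
  rw [finrank_span_singleton ha0] at hWd
  have hWU := Submodule.finrank_sup_add_finrank_inf_eq W U
  have hWU' := Submodule.finrank_le (W ⊔ U)
  have haWU : a ∉ W ⊓ U := fun h => haW h.1
  have hWUlt : finrank R ↥(W ⊓ U) < finrank R U :=
    Submodule.finrank_lt_finrank_of_lt (lt_of_le_of_ne inf_le_right fun h =>
      haWU (h.ge (hAU haA)))
  have hZ'd : finrank R ↥(W ⊓ U) = k := by omega
  refine ⟨A ⊔ R ∙ x, A ⊔ R ∙ y, A ⊔ R ∙ z, W ⊓ U, by omega, by omega, by omega, hZ'd,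
    fun h => hyX (h ▸ mem_sup_span_singleton A y), le_sup_left, le_sup_left, le_sup_left,
    sup_span_singleton_le hAU hxU, sup_span_singleton_le hAU hyU, inf_le_right, ?_⟩
  have h1 : (A ⊔ R ∙ z) ⊓ U = A := by
    rw [sup_span_singleton_inf (by rwa [sup_eq_right.2 hAU]), inf_eq_left.2 hAU]
  have h2 : (A ⊔ R ∙ z) ⊓ (W ⊓ U) < A := by
    refine lt_of_le_of_ne ((inf_le_inf_left _ inf_le_right).trans h1.le) fun h => haW ?_
    have : a ∈ (A ⊔ R ∙ z) ⊓ (W ⊓ U) := h.ge haA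
    exact this.2.1
  have h3 := Submodule.finrank_lt_finrank_of_lt h2
  omega

/-- The star of `A` goes into a star or into a top, and for `A ≤ U` it goes into a star exactly
when the top of `U` goes into a top. The centres involved are `f X ⊓ f Y` and `f X ⊔ f Y` for the
two common elements `X`, `Y`, so that equal types would bring the images of `Z` and `Z'` of
`exists_adjacent_and_distant` too close together. -/
theorem isStarAt_iff_top (hr : IsRank r) (hf : IsIsometricAt r r₀ k f) (hk : 2 ≤ k)
    (hn : k + 2 ≤ finrank R V) {A U : Submodule R V} (hAU : A ≤ U)
    (hA : finrank R A + 1 = k) (hU : finrank R U = k + 1) :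
    (IsStarAt r r₀ k f A ∨ IsTopAt r r₀ k f A) ∧
    (IsStarAt r r₀ k f A ↔ ∃ c, r c = r₀ + k + 1 ∧ ∀ X ≤ U, finrank R X = k → f X ≤ c) := by
  obtain ⟨m, rfl⟩ : ∃ m, k = m + 1 := ⟨k - 1, by omega⟩
  obtain ⟨X, Y, Z, Z', hX, hY, hZ, hZ', hXY, hAX, hAY, hAZ, hXU, hYU, hZU, hd⟩ :=
    exists_adjacent_and_distant hAU hA hU hk hn
  have hne := hf.ne hX hY hXY
  have key : ∀ B : Submodule R V, ∀ C : Submodule R V, finrank R B = m + 1 → finrank R C = m + 1 →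
      m ≤ finrank R ↥(B ⊓ C) → f B ≠ f C → r (f B ⊓ f C) = r₀ + m := by
    intro B C hB hC hBC hBC'
    rw [hf B C hB hC]
    have := finrank_inf_lt_of_ne (hB.trans hC.symm) (fun h => hBC' (by rw [h]))
    omega
  have hstar : ∀ B C : Submodule R V, finrank R B = m + 1 → finrank R C = m + 1 → A ≤ B → A ≤ C →
      m ≤ finrank R ↥(B ⊓ C) := fun B C _ _ hB hC => by
    have := Submodule.finrank_mono (le_inf hB hC)
    omega
  have htop : ∀ B C : Submodule R V, finrank R B = m + 1 → finrank R C = m + 1 → B ≤ U → C ≤ U →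
      m ≤ finrank R ↥(B ⊓ C) := fun B C hBd hCd hB hC => by
    have := Submodule.finrank_mono (sup_le hB hC)
    have := Submodule.finrank_sup_add_finrank_inf_eq B C
    omega
  have hi : r (f X ⊓ f Y) = r₀ + m := key X Y hX hY (hstar X Y hX hY hAX hAY) hne
  have hs : r (f X ⊔ f Y) = r₀ + m + 2 := by
    have := hr.sup_add_inf (f X) (f Y)
    have := hf.rank_eq hX
    have := hf.rank_eq hY
    omega
  have hcl1 := hr.clique_le_or_le (K := {x | ∃ B, A ≤ B ∧ finrank R B = m + 1 ∧ f B = x})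
    (m := r₀ + m) (by rintro _ ⟨B, -, hB, rfl⟩; exact hf.rank_eq hB)
    (by
      rintro _ ⟨B, hB, hBd, rfl⟩ _ ⟨C, hC, hCd, rfl⟩ h
      exact key B C hBd hCd (hstar B C hBd hCd hB hC) h)
    ⟨X, hAX, hX, rfl⟩ ⟨Y, hAY, hY, rfl⟩ hne
  have hcl2 := hr.clique_le_or_le (K := {x | ∃ B, B ≤ U ∧ finrank R B = m + 1 ∧ f B = x})
    (m := r₀ + m) (by rintro _ ⟨B, -, hB, rfl⟩; exact hf.rank_eq hB)
    (by
      rintro _ ⟨B, hB, hBd, rfl⟩ _ ⟨C, hC, hCd, rfl⟩ h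
      exact key B C hBd hCd (htop B C hBd hCd hB hC) h)
    ⟨X, hXU, hX, rfl⟩ ⟨Y, hYU, hY, rfl⟩ hne
  have hZZ := hf Z Z' hZ hZ'
  have hZZ' := hr.sup_add_inf (f Z) (f Z')
  rw [hf.rank_eq hZ, hf.rank_eq hZ'] at hZZ'
  -- The images of `Z` and `Z'` are too far apart to lie in a common star or top.
  have hnot1 : ¬ (f X ⊓ f Y ≤ f Z ∧ f X ⊓ f Y ≤ f Z') := fun h => by
    have := hr.mono (le_inf h.1 h.2)
    omega
  have hnot2 : ¬ (f Z ≤ f X ⊔ f Y ∧ f Z' ≤ f X ⊔ f Y) := fun h => by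
    have := hr.mono (sup_le h.1 h.2)
    omega
  refine ⟨hcl1.imp (fun h => ⟨f X ⊓ f Y, by omega, fun B hB hBd => h _ ⟨B, hB, hBd, rfl⟩⟩)
    fun h => ⟨f X ⊔ f Y, by omega, fun B hB hBd => h _ ⟨B, hB, hBd, rfl⟩⟩, ?_, ?_⟩
  · rintro ⟨c, hc, hcA⟩
    have hc' : c = f X ⊓ f Y := hr.eq_of_le (le_inf (hcA X hAX hX) (hcA Y hAY hY)) (by omega)
    refine ⟨f X ⊔ f Y, by omega, fun B hB hBd => ?_⟩
    refine (hcl2.resolve_left fun h => hnot1 ⟨?_, h _ ⟨Z', hZU, hZ', rfl⟩⟩) _ ⟨B, hB, hBd, rfl⟩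
    exact hc' ▸ hcA Z hAZ hZ
  · rintro ⟨c, hc, hcU⟩
    have hc' : f X ⊔ f Y = c := hr.eq_of_le (sup_le (hcU X hXU hX) (hcU Y hYU hY)) (by omega)
    refine ⟨f X ⊓ f Y, by omega, fun B hB hBd => ?_⟩
    refine (hcl1.resolve_right fun h => hnot2 ⟨h _ ⟨Z, hAZ, hZ, rfl⟩, ?_⟩) _ ⟨B, hB, hBd, rfl⟩
    exact hc' ▸ hcU Z' hZU hZ'

/-- Either all stars are sent into stars, or all stars are sent into tops. -/
theorem forall_isStarAt_or_forall_isTopAt (hr : IsRank r) (hf : IsIsometricAt r r₀ k f)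
    (hk : 2 ≤ k) (hn : k + 2 ≤ finrank R V) :
    (∀ C : Submodule R V, finrank R C + 1 = k → IsStarAt r r₀ k f C) ∨
      ∀ C : Submodule R V, finrank R C + 1 = k → IsTopAt r r₀ k f C := by
  have hstep : ∀ A B : Submodule R V, finrank R A + 1 = k → finrank R B + 1 = k →
      k ≤ finrank R ↥(A ⊓ B) + 2 → (IsStarAt r r₀ k f A ↔ IsStarAt r r₀ k f B) := by
    intro A B hA hB hAB
    have h := Submodule.finrank_sup_add_finrank_inf_eq A B
    obtain ⟨U, hU, -, hUd⟩ := exists_finrank_eq_between (le_top : A ⊔ B ≤ ⊤) (m := k + 1)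
      (by omega) (by rw [finrank_top]; omega)
    rw [(isStarAt_iff_top hr hf hk hn (le_sup_left.trans hU) hA hUd).2,
      (isStarAt_iff_top hr hf hk hn (le_sup_right.trans hU) hB hUd).2]
  by_cases hex : ∃ C : Submodule R V, finrank R C + 1 = k ∧ IsStarAt r r₀ k f C
  · obtain ⟨C, hC, hCs⟩ := hex
    refine Or.inl fun D hD => ?_
    obtain ⟨p⟩ := grassmannGraph_preconnected (R := R) (V := V) (k := k - 1)
      ⟨C, by omega⟩ ⟨D, by omega⟩
    have hwalk : ∀ X Y : Grass R V (k - 1), (grassmannGraph R V (k - 1)).Walk X Y →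
        IsStarAt r r₀ k f X.1 → IsStarAt r r₀ k f Y.1 := by
      intro X Y p
      induction p with
      | nil => exact id
      | @cons X Z Y h p ih =>
        intro hX
        have h' : finrank R ↥(X.1 ⊓ Z.1) + 1 = k - 1 := h
        have hX2 := X.2
        have hZ2 := Z.2
        exact ih ((hstep X.1 Z.1 (by omega) (by omega) (by omega)).1 hX)
    exact hwalk _ _ p hCs
  · push Not at hex
    refine Or.inr fun C hC => ?_
    obtain ⟨U, hU, -, hUd⟩ := exists_finrank_eq_between (le_top : C ≤ ⊤) (m := k + 1)
      (by omega) (by rw [finrank_top]; omega)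
    exact (isStarAt_iff_top hr hf hk hn hU hC hUd).1.resolve_left (hex C hC)

end Level

/-! ### Descent to points -/

section Descent

variable {R V : Type*} [DivisionRing R] [AddCommGroup V] [Module R V]
  {L : Type*} [Lattice L] {r : L → ℕ} {r₀ k : ℕ} {f g : Submodule R V → L}

/-- Two distinct elements of rank `r₀ + j` below `f X` already join to `f X`. -/
theorem IsIsometricAt.le_of_rank_sup_le {j : ℕ} (hr : IsRank r) (hf : IsIsometricAt r r₀ (j + 1) f)
    {X : Submodule R V} (hX : finrank R X = j + 1) {a b t : L} (ha : a ≤ f X) (hb : b ≤ f X)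
    (hab : a ≠ b) (hra : r a = r₀ + j) (hrb : r b = r₀ + j) (hat : a ≤ t) (hbt : b ≤ t) :
    f X ≤ t := by
  have h1 : r a < r (a ⊔ b) := by
    refine hr.strictMono (lt_of_le_of_ne le_sup_left fun he => hab ?_)
    exact (hr.eq_of_le (sup_eq_left.1 he.symm) (by omega)).symm
  have h2 := hr.eq_of_le (sup_le ha hb) (by have := hf.rank_eq hX; omega)
  exact h2 ▸ sup_le hat hbt

variable [FiniteDimensional R V]

/-- The centres of the stars containing the images of the stars preserve defects of intersections:
compare with extensions `X ≥ A` and `Y ≥ B` whose intersection is as small,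
respectively as large, as possible. -/
theorem IsIsometricAt.descend {j : ℕ} (hr : IsRank r) (hn : 2 * (j + 1) ≤ finrank R V)
    (hf : IsIsometricAt r r₀ (j + 1) f)
    (hg : ∀ A : Submodule R V, finrank R A = j → r (g A) = r₀ + j)
    (hgf : ∀ A X : Submodule R V, finrank R A = j → finrank R X = j + 1 → A ≤ X → g A ≤ f X) :
    IsIsometricAt r r₀ j g := by
  intro A B hA hB
  by_cases hAB : A = B
  · subst hAB
    rw [inf_idem, inf_idem, hg A hA, hA]
  refine le_antisymm ?_ ?_
  · obtain ⟨X, Y, hAX, hBY, hX, hY, hXY⟩ := exists_extensions (A := A) (B := B)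
      (a := j + 1) (b := j + 1) (by omega) (by omega) (by omega)
    rw [← hXY, ← hf X Y hX hY]
    exact hr.mono (inf_le_inf (hgf A X hA hX hAX) (hgf B Y hB hY hBY))
  · have hlt := finrank_inf_lt_of_ne (hA.trans hB.symm) hAB
    have hlt' := finrank_inf_lt_of_ne (hB.trans hA.symm) (Ne.symm hAB)
    obtain ⟨a, haA, haI⟩ := exists_mem_notMem_of_finrank_lt hlt
    obtain ⟨b, hbB, hbI⟩ := exists_mem_notMem_of_finrank_lt hlt'
    have haB : a ∉ B := fun h => haI ⟨haA, h⟩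
    have hbA : b ∉ A := fun h => hbI ⟨hbB, h⟩
    have hX := finrank_sup_span_singleton hbA
    have hY := finrank_sup_span_singleton haB
    have hbC : b ∉ A ⊓ B ⊔ R ∙ a := fun h =>
      hbA (sup_span_singleton_le inf_le_left haA h)
    have h1 : A ⊓ B ⊔ R ∙ a ⊔ R ∙ b ≤ (A ⊔ R ∙ b) ⊓ (B ⊔ R ∙ a) :=
      le_inf (sup_le_sup_right (sup_span_singleton_le inf_le_left haA) _)
        (sup_span_singleton_le (sup_le_sup_right inf_le_right _)
          ((le_sup_left : B ≤ B ⊔ R ∙ a) hbB))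
    have h2 := Submodule.finrank_mono h1
    rw [finrank_sup_span_singleton hbC, finrank_sup_span_singleton haI] at h2
    have h3 := hf _ _ (hX.trans (by rw [hA])) (hY.trans (by rw [hB]))
    have hgA := hgf A _ hA (hX.trans (by rw [hA])) le_sup_left
    have hgB := hgf B _ hB (hY.trans (by rw [hB])) le_sup_left
    set x := f (A ⊔ R ∙ b)
    set y := f (B ⊔ R ∙ a)
    have hx : r x = r₀ + (j + 1) := hf.rank_eq (hX.trans (by rw [hA]))
    have hy : r y = r₀ + (j + 1) := hf.rank_eq (hY.trans (by rw [hB]))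
    have h4 := hr.sup_add_inf (x ⊓ y) (g A)
    have h5 : r (x ⊓ y ⊔ g A) ≤ r x := hr.mono (sup_le inf_le_left hgA)
    have h6 := hr.sup_add_inf (x ⊓ y ⊓ g A) (g B)
    have h7 : r (x ⊓ y ⊓ g A ⊔ g B) ≤ r y :=
      hr.mono (sup_le (inf_le_left.trans inf_le_right) hgB)
    have h8 : r (x ⊓ y ⊓ g A ⊓ g B) ≤ r (g A ⊓ g B) := hr.mono (inf_le_inf_right _ inf_le_right)
    have := hg A hA
    have := hg B hB
    omega

/-- Three `j`-dimensional subspaces through `C` that are not in one `(j + 1)`-dimensional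
subspace: their images form a star, since a top would force `f` to identify two subspaces. -/
theorem inf_le_of_not_le_sup {j : ℕ} (hr : IsRank r) (hf : IsIsometricAt r r₀ (j + 2) f)
    (hg : IsIsometricAt r r₀ (j + 1) g)
    (hgf : ∀ A X : Submodule R V, finrank R A = j + 1 → finrank R X = j + 2 → A ≤ X → g A ≤ f X)
    {C A₁ A₂ A₃ : Submodule R V} (hC : finrank R C = j) (h1 : finrank R A₁ = j + 1)
    (h2 : finrank R A₂ = j + 1) (h3 : finrank R A₃ = j + 1) (hC1 : C ≤ A₁) (hC2 : C ≤ A₂)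
    (hC3 : C ≤ A₃) (h12 : A₁ ≠ A₂) (h : ¬ A₃ ≤ A₁ ⊔ A₂) : g A₁ ⊓ g A₂ ≤ g A₃ := by
  by_contra hcon
  have hinf : ∀ A B : Submodule R V, finrank R A = j + 1 → finrank R B = j + 1 → C ≤ A → C ≤ B →
      A ≠ B → finrank R ↥(A ⊓ B) = j ∧ finrank R ↥(A ⊔ B) = j + 2 := by
    intro A B hA hB hCA hCB hAB
    have h4 := finrank_inf_lt_of_ne (hA.trans hB.symm) hAB
    have h5 := Submodule.finrank_mono (le_inf hCA hCB)
    have h6 := Submodule.finrank_sup_add_finrank_inf_eq A B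
    omega
  have h13 : A₁ ≠ A₃ := fun he => h (he ▸ le_sup_left)
  have h23 : A₂ ≠ A₃ := fun he => h (he ▸ le_sup_right)
  obtain ⟨i12, s12⟩ := hinf A₁ A₂ h1 h2 hC1 hC2 h12
  obtain ⟨i13, s13⟩ := hinf A₁ A₃ h1 h3 hC1 hC3 h13
  obtain ⟨i23, s23⟩ := hinf A₂ A₃ h2 h3 hC2 hC3 h23
  have g12 := hg A₁ A₂ h1 h2
  have g13 := hg A₁ A₃ h1 h3
  have g23 := hg A₂ A₃ h2 h3
  rw [i12] at g12
  rw [i13] at g13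
  rw [i23] at g23
  have h4 := hr.le_sup_of_not_inf_le (hg.rank_eq h3) g12 g13 g23 hcon
  have hX : g A₁ ⊔ g A₂ ≤ f (A₁ ⊔ A₂) :=
    sup_le (hgf _ _ h1 s12 le_sup_left) (hgf _ _ h2 s12 le_sup_right)
  have hY : g A₁ ⊔ g A₃ ≤ f (A₁ ⊔ A₂) ⊓ f (A₁ ⊔ A₃) :=
    le_inf (sup_le (le_sup_left.trans hX) (h4.trans hX))
      (sup_le (hgf _ _ h1 s13 le_sup_left) (hgf _ _ h3 s13 le_sup_right))
  have h5 := hr.mono hY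
  rw [hf _ _ s12 s13] at h5
  have h6 := hr.sup_add_inf (g A₁) (g A₃)
  rw [g13, hg.rank_eq h1, hg.rank_eq h3] at h6
  have h7 := finrank_inf_lt_of_ne (s12.trans s13.symm)
    (fun he => h (le_sup_right.trans he.ge))
  omega

/-- The map induced on subspaces of one dimension less is again an isometric map sending stars
into stars. -/
theorem IsStarIsometry.descend {j : ℕ} (hr : IsRank r) (hn : 2 * (j + 2) ≤ finrank R V)
    (hf : IsStarIsometry r r₀ (j + 2) f) :
    ∃ g : Submodule R V → L, IsStarIsometry r r₀ (j + 1) g ∧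
      ∀ A X : Submodule R V, finrank R A = j + 1 → finrank R X = j + 2 → A ≤ X → g A ≤ f X := by
  classical
  have hstar : ∀ C : Submodule R V, ∃ c, finrank R C = j + 1 →
      r c = r₀ + (j + 1) ∧ ∀ A, C ≤ A → finrank R A = j + 2 → c ≤ f A := fun C => by
    by_cases hC : finrank R C = j + 1
    · obtain ⟨c, hc, hcA⟩ := hf.star C (by omega)
      exact ⟨c, fun _ => ⟨by omega, hcA⟩⟩
    · exact ⟨f C, fun h => absurd h hC⟩
  choose g hg using hstar
  have hgf : ∀ A X : Submodule R V, finrank R A = j + 1 → finrank R X = j + 2 → A ≤ X →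
      g A ≤ f X := fun A X hA hX hAX => (hg A hA).2 X hAX hX
  have hiso : IsIsometricAt r r₀ (j + 1) g :=
    hf.isometric.descend hr hn (fun A hA => (hg A hA).1) hgf
  refine ⟨g, ⟨hiso, fun C hC => ?_⟩, hgf⟩
  replace hC : finrank R C = j := by omega
  obtain ⟨x, -, hx⟩ := exists_mem_notMem_of_finrank_lt (A := C) (B := ⊤)
    (by rw [finrank_top]; omega)
  have h1 := finrank_sup_span_singleton hx
  obtain ⟨y, -, hy⟩ := exists_mem_notMem_of_finrank_lt (A := C ⊔ R ∙ x) (B := ⊤)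
    (by rw [finrank_top]; omega)
  have hyC : y ∉ C := fun h => hy ((le_sup_left : C ≤ _) h)
  have h2 := finrank_sup_span_singleton hyC
  have hC1 : C ≤ C ⊔ R ∙ x := le_sup_left
  have hC2 : C ≤ C ⊔ R ∙ y := le_sup_left
  have h12 : C ⊔ R ∙ x ≠ C ⊔ R ∙ y := fun h => hy (h ▸ mem_sup_span_singleton C y)
  generalize C ⊔ R ∙ x = A₁ at *
  generalize C ⊔ R ∙ y = A₂ at *
  rw [hC] at h1 h2
  have hinf : ∀ A B : Submodule R V, finrank R A = j + 1 → finrank R B = j + 1 → C ≤ A → C ≤ B →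
      A ≠ B → finrank R ↥(A ⊓ B) = j := by
    intro A B hA hB hCA hCB hAB
    have h4 := finrank_inf_lt_of_ne (hA.trans hB.symm) hAB
    have h5 := Submodule.finrank_mono (le_inf hCA hCB)
    omega
  have hi12 := hiso A₁ A₂ h1 h2
  rw [hinf A₁ A₂ h1 h2 hC1 hC2 h12] at hi12
  refine ⟨g A₁ ⊓ g A₂, by omega, fun A hCA hA => ?_⟩
  by_cases hle : A ≤ A₁ ⊔ A₂
  · by_cases hA1 : A = A₁
    · exact hA1 ▸ inf_le_left
    -- Replace `A₂` by a subspace `A₄` outside `A₁ ⊔ A₂`.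
    have h3 := Submodule.finrank_sup_add_finrank_inf_eq A₁ A₂
    rw [hinf A₁ A₂ h1 h2 hC1 hC2 h12] at h3
    obtain ⟨z, -, hz⟩ := exists_mem_notMem_of_finrank_lt (A := A₁ ⊔ A₂) (B := ⊤)
      (by rw [finrank_top]; omega)
    have hzC : z ∉ C := fun h => hz ((hC1.trans le_sup_left) h)
    have h4 := finrank_sup_span_singleton hzC
    have hC4 : C ≤ C ⊔ R ∙ z := le_sup_left
    have h4le : ¬ C ⊔ R ∙ z ≤ A₁ ⊔ A₂ := fun h => hz (h (mem_sup_span_singleton C z))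
    generalize C ⊔ R ∙ z = A₄ at *
    rw [hC] at h4
    have h14 : A₁ ≠ A₄ := fun h => h4le (h ▸ le_sup_left)
    have h5 : g A₁ ⊓ g A₂ ≤ g A₄ :=
      inf_le_of_not_le_sup hr hf.isometric hiso hgf hC h1 h2 h4 hC1 hC2 hC4 h12 h4le
    have hi14 := hiso A₁ A₄ h1 h4
    rw [hinf A₁ A₄ h1 h4 hC1 hC4 h14] at hi14
    have h6 : g A₁ ⊓ g A₂ = g A₁ ⊓ g A₄ :=
      hr.eq_of_le (le_inf inf_le_left h5) (by omega)
    rw [h6]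
    refine inf_le_of_not_le_sup hr hf.isometric hiso hgf hC h1 h4 hA hC1 hC4 hCA h14 fun h => ?_
    have h7 := Submodule.finrank_sup_add_finrank_inf_eq A₁ A₄
    rw [hinf A₁ A₄ h1 h4 hC1 hC4 h14] at h7
    have h8 := finrank_inf_lt_of_ne (A := A₁ ⊔ A₂) (B := A₁ ⊔ A₄) (by omega)
      (fun h => h4le (le_sup_right.trans h.ge))
    have h9 : A₁ ⊔ A ≤ (A₁ ⊔ A₂) ⊓ (A₁ ⊔ A₄) := sup_le (le_inf le_sup_left le_sup_left)
      (le_inf hle h)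
    have h10 := Submodule.finrank_mono h9
    have h11 := Submodule.finrank_sup_add_finrank_inf_eq A₁ A
    rw [hinf A₁ A h1 hA hC1 hCA (Ne.symm hA1)] at h11
    omega
  · exact inf_le_of_not_le_sup hr hf.isometric hiso hgf hC h1 h2 hA hC1 hC2 hCA h12 hle

/-- Repeated descent yields a map on points; the image of a subspace is the join of the images of
its points. -/
theorem IsStarIsometry.exists_points {j : ℕ} (hr : IsRank r) (hn : 2 * (j + 1) ≤ finrank R V)
    (hf : IsStarIsometry r r₀ (j + 1) f) :
    ∃ g : Submodule R V → L, IsStarIsometry r r₀ 1 g ∧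
      (∀ P X : Submodule R V, finrank R P = 1 → finrank R X = j + 1 → P ≤ X → g P ≤ f X) ∧
      ∀ (X : Submodule R V) (t : L), finrank R X = j + 1 →
        (∀ P ≤ X, finrank R P = 1 → g P ≤ t) → f X ≤ t := by
  induction j generalizing f with
  | zero =>
    refine ⟨f, hf, fun P X hP hX hPX => ?_, fun X t hX h => h X le_rfl hX⟩
    rw [Submodule.eq_of_le_of_finrank_eq hPX (hP.trans hX.symm)]
  | succ j ih =>
    obtain ⟨f', hf', hf'f⟩ := hf.descend hr hn
    obtain ⟨g, hg, hgf', hg'⟩ := ih (by omega) hf'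
    refine ⟨g, hg, fun P X hP hX hPX => ?_, fun X t hX h => ?_⟩
    · obtain ⟨A, hPA, hAX, hA⟩ := exists_finrank_eq_between hPX (m := j + 1) (by omega) (by omega)
      exact (hgf' P A hP hA hPA).trans (hf'f A X hA hX hAX)
    · obtain ⟨A, -, hAX, hA⟩ := exists_finrank_eq_between (bot_le : ⊥ ≤ X) (m := j + 1)
        (by rw [finrank_bot]; omega) (by omega)
      obtain ⟨x, hxX, hxA⟩ := exists_mem_notMem_of_finrank_lt (A := A) (B := X) (by omega)
      obtain ⟨B, hxB, hBX, hB⟩ := exists_finrank_eq_between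
        ((Submodule.span_singleton_le_iff_mem x X).2 hxX) (m := j + 1)
        ((finrank_span_singleton (K := R) (fun h : x = 0 => hxA (h ▸ A.zero_mem))).le.trans (by omega))
        (by omega)
      have hAB : A ≠ B := fun h => hxA (h ▸ hxB (Submodule.mem_span_singleton_self x))
      exact hf.isometric.le_of_rank_sup_le hr hX (hf'f A X hA hX hAX) (hf'f B X hB hX hBX)
        (hf'.isometric.ne hA hB hAB) (hf'.isometric.rank_eq hA) (hf'.isometric.rank_eq hB)
        (hg' A t hA fun P hP => h P (hP.trans hAX)) (hg' B t hB fun P hP => h P (hP.trans hBX))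

end Descent

/-! ### Collineations that need not be surjective -/

section Collineation

variable {R R' V W : Type*} [DivisionRing R] [DivisionRing R'] [AddCommGroup V] [Module R V]
  [AddCommGroup W] [Module R' W]

theorem span_singleton_eq_of_mem {x y : W} (hx : x ≠ 0) (h : x ∈ Submodule.span R' {y}) :
    Submodule.span R' {x} = Submodule.span R' {y} := by
  obtain ⟨c, rfl⟩ := Submodule.mem_span_singleton.1 h
  have hc : c ≠ 0 := fun h0 => hx (by rw [h0, zero_smul])
  exact Submodule.span_singleton_smul_eq (IsUnit.mk0 c hc) y

/-- A system of nonzero representatives of the images of the points under a collineation: `h`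
sends collinear points to collinear points and noncollinear points to noncollinear points. -/
structure IsCollineation (R R' : Type*) {V W : Type*} [DivisionRing R] [DivisionRing R']
    [AddCommGroup V] [Module R V] [AddCommGroup W] [Module R' W] (h : V → W) : Prop where
  ne_zero : ∀ x, x ≠ 0 → h x ≠ 0
  mem_span_pair : ∀ x y z, x ≠ 0 → y ≠ 0 → z ≠ 0 → z ∈ Submodule.span R {x, y} →
    h z ∈ Submodule.span R' {h x, h y}
  notMem_span_singleton : ∀ x y, x ≠ 0 → y ∉ Submodule.span R {x} → h y ∉ Submodule.span R' {h x}
  notMem_span_pair : ∀ x y z, x ≠ 0 → y ∉ Submodule.span R {x} → z ∉ Submodule.span R {x, y} →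
    h z ∉ Submodule.span R' {h x, h y}

namespace IsCollineation

variable {h : V → W}

theorem mem_span_singleton (hh : IsCollineation R R' h) {x z : V} (hx : x ≠ 0) (hz : z ≠ 0)
    (hzx : z ∈ Submodule.span R {x}) : h z ∈ Submodule.span R' {h x} := by
  have := hh.mem_span_pair x x z hx hx hz (by simpa using hzx)
  simpa using this

/-- On a hyperplane not containing `x₀` the representatives can be chosen such that `x₀ + x` is
represented by the sum of those of `x₀` and `x`. -/
theorem exists_normalized (hh : IsCollineation R R' h) {x₀ : V} (H : Submodule R V)
    (hx₀ : x₀ ∉ H) :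
    ∃ l : V → W, l 0 = 0 ∧ ∀ x ∈ H, x ≠ 0 → l x ≠ 0 ∧
      Submodule.span R' {h x} = Submodule.span R' {l x} ∧
      h (x₀ + x) ∈ Submodule.span R' {h x₀ + l x} := by
  classical
  have hx₀0 : x₀ ≠ 0 := fun h0 => hx₀ (h0 ▸ H.zero_mem)
  have key : ∀ x, ∃ w, (x = 0 → w = 0) ∧ (x ∈ H → x ≠ 0 → w ≠ 0 ∧
      Submodule.span R' {h x} = Submodule.span R' {w} ∧
      h (x₀ + x) ∈ Submodule.span R' {h x₀ + w}) := by
    intro x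
    by_cases hx : x ∈ H ∧ x ≠ 0
    swap
    · exact ⟨0, fun _ => rfl, fun h1 h2 => absurd ⟨h1, h2⟩ hx⟩
    obtain ⟨hxH, hx0⟩ := hx
    have hne : x₀ + x ≠ 0 := fun h0 => hx₀ <| by
      rw [eq_neg_of_add_eq_zero_left h0]; exact H.neg_mem hxH
    have h1 : x₀ + x ∉ Submodule.span R {x} := fun h1 => hx₀ <| by
      have h2 := (Submodule.span_singleton_le_iff_mem x H).2 hxH h1
      simpa using H.sub_mem h2 hxH
    have h2 : x₀ + x ∉ Submodule.span R {x₀} := fun h2 => hx₀ <| by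
      obtain ⟨c, hc⟩ := Submodule.mem_span_singleton.1 h2
      have h3 : (c - 1) • x₀ = x := by rw [sub_smul, hc, one_smul, add_sub_cancel_left]
      have h4 : c - 1 ≠ 0 := fun h0 => hx0 (by rw [← h3, h0, zero_smul])
      rwa [← h3, H.smul_mem_iff h4] at hxH
    obtain ⟨a, b, hab⟩ := Submodule.mem_span_pair.1 (hh.mem_span_pair x₀ x (x₀ + x) hx₀0 hx0 hne
      (Submodule.add_mem _ (Submodule.subset_span (by simp)) (Submodule.subset_span (by simp))))
    have ha : a ≠ 0 := fun ha => hh.notMem_span_singleton x (x₀ + x) hx0 h1 <| by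
      rw [← hab, ha, zero_smul, zero_add]
      exact Submodule.smul_mem _ _ (Submodule.mem_span_singleton_self _)
    have hb : b ≠ 0 := fun hb => hh.notMem_span_singleton x₀ (x₀ + x) hx₀0 h2 <| by
      rw [← hab, hb, zero_smul, add_zero]
      exact Submodule.smul_mem _ _ (Submodule.mem_span_singleton_self _)
    have hab0 : a⁻¹ * b ≠ 0 := mul_ne_zero (inv_ne_zero ha) hb
    refine ⟨(a⁻¹ * b) • h x, fun h0 => absurd h0 hx0, fun _ _ =>
      ⟨smul_ne_zero hab0 (hh.ne_zero x hx0),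
        (Submodule.span_singleton_smul_eq (IsUnit.mk0 _ hab0) _).symm, ?_⟩⟩
    refine Submodule.mem_span_singleton.2 ⟨a, ?_⟩
    rw [smul_add, smul_smul, mul_inv_cancel_left₀ ha, hab]
  choose l hl using key
  exact ⟨l, (hl 0).1 rfl, fun x hx hx0 => (hl x).2 hx hx0⟩

/-- The normalized representatives form a semilinear map on the hyperplane. -/
theorem exists_semilinear_on (hh : IsCollineation R R' h) {x₀ : V} (H : Submodule R V)
    (hx₀ : x₀ ∉ H) (hH : ∀ x ∈ H, ∃ z ∈ H, z ∉ Submodule.span R {x}) :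
    ∃ (σ : R →+* R') (l : V → W), l 0 = 0 ∧
      (∀ x ∈ H, ∀ y ∈ H, l (x + y) = l x + l y) ∧ (∀ a, ∀ x ∈ H, l (a • x) = σ a • l x) ∧
      (∀ x ∈ H, x ≠ 0 → Submodule.span R' {h x} = Submodule.span R' {l x}) ∧
      ∀ x ∈ H, h (x₀ + x) ∈ Submodule.span R' {h x₀ + l x} := by
  classical
  obtain ⟨l, hl0, hl⟩ := hh.exists_normalized H hx₀
  have hx₀0 : x₀ ≠ 0 := fun h0 => hx₀ (h0 ▸ H.zero_mem)
  have hne : ∀ x ∈ H, x₀ + x ≠ 0 := fun x hx h0 => hx₀ <| by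
    rw [eq_neg_of_add_eq_zero_left h0]; exact H.neg_mem hx
  -- Independence of `h x₀`, `l x`, `l y` for independent `x`, `y` in `H`.
  have hind : ∀ x ∈ H, ∀ y ∈ H, x ≠ 0 → y ∉ Submodule.span R {x} → ∀ a b c : R',
      a • h x₀ + b • l x + c • l y = 0 → a = 0 ∧ b = 0 ∧ c = 0 := by
    intro x hx y hy hx0 hyx a b c habc
    have hy0 : y ≠ 0 := fun h0 => hyx (h0 ▸ Submodule.zero_mem _)
    have hxy : x₀ ∉ Submodule.span R {x, y} := fun hm => hx₀ <|
      (Submodule.span_le.2 (by rintro z (rfl | rfl) <;> assumption)) hm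
    have h3 := hh.notMem_span_pair x y x₀ hx0 hyx hxy
    have h2 := hh.notMem_span_singleton x y hx0 hyx
    rw [Submodule.span_insert, (hl x hx hx0).2.1, (hl y hy hy0).2.1, ← Submodule.span_insert] at h3
    have ha : a = 0 := by
      by_contra ha
      refine h3 (Submodule.mem_span_pair.2 ⟨-(a⁻¹ * b), -(a⁻¹ * c), ?_⟩)
      have : a⁻¹ • (a • h x₀ + b • l x + c • l y) = 0 := by rw [habc, smul_zero]
      rw [smul_add, smul_add, smul_smul, smul_smul, smul_smul, inv_mul_cancel₀ ha, one_smul] at this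
      rw [neg_smul, neg_smul, ← sub_eq_zero, ← neg_eq_zero, ← this]
      abel
    have hc : c = 0 := by
      by_contra hc
      refine h2 ?_
      rw [(hl x hx hx0).2.1, ← Submodule.span_singleton_le_iff_mem, (hl y hy hy0).2.1,
        Submodule.span_singleton_le_iff_mem]
      refine Submodule.mem_span_singleton.2 ⟨-(c⁻¹ * b), ?_⟩
      rw [ha, zero_smul, zero_add] at habc
      have : c⁻¹ • (b • l x + c • l y) = 0 := by rw [habc, smul_zero]
      rw [smul_add, smul_smul, smul_smul, inv_mul_cancel₀ hc, one_smul] at this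
      rw [neg_smul, neg_eq_of_add_eq_zero_right this]
    refine ⟨ha, ?_, hc⟩
    rw [ha, hc, zero_smul, zero_smul, zero_add, add_zero] at habc
    exact (smul_eq_zero.1 habc).resolve_right (hl x hx hx0).1
  have hpair : ∀ x ∈ H, ∀ y ∈ H, x ≠ 0 → y ≠ 0 → ∀ z ∈ H, z ≠ 0 → z ∈ Submodule.span R {x, y} →
      l z ∈ Submodule.span R' {l x, l y} := by
    intro x hx y hy hx0 hy0 z hz hz0 hzxy
    have h1 := hh.mem_span_pair x y z hx0 hy0 hz0 hzxy
    rw [Submodule.span_insert, (hl x hx hx0).2.1, (hl y hy hy0).2.1, ← Submodule.span_insert,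
      ← Submodule.span_singleton_le_iff_mem, (hl z hz hz0).2.1,
      Submodule.span_singleton_le_iff_mem] at h1
    exact h1
  have hmem : ∀ x ∈ H, h (x₀ + x) ∈ Submodule.span R' {h x₀ + l x} := by
    intro x hx
    by_cases hx0 : x = 0
    · rw [hx0, hl0, add_zero, add_zero]
      exact Submodule.mem_span_singleton_self _
    · exact (hl x hx hx0).2.2
  -- `x₀ + x + y` is on the line of `x₀ + x` and `y`; exchanging `x` and `y` yields a second line
  -- through it, and the two lines determine the point.
  have hline : ∀ x ∈ H, ∀ y ∈ H, y ≠ 0 → ∃ a b : R',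
      a • (h x₀ + l x) + b • l y = h (x₀ + (x + y)) := by
    intro x hx y hy hy0
    have h1 := hh.mem_span_pair (x₀ + x) y (x₀ + (x + y)) (hne x hx) hy0
      (hne _ (H.add_mem hx hy)) (Submodule.mem_span_pair.2 ⟨1, 1, by
        rw [one_smul, one_smul, add_assoc]⟩)
    rw [Submodule.span_insert, (hl y hy hy0).2.1,
      span_singleton_eq_of_mem (hh.ne_zero _ (hne x hx)) (hmem x hx),
      ← Submodule.span_insert] at h1
    exact Submodule.mem_span_pair.1 h1
  have hadd_ind : ∀ x ∈ H, ∀ y ∈ H, x ≠ 0 → y ∉ Submodule.span R {x} →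
      l (x + y) = l x + l y := by
    intro x hx y hy hx0 hyx
    have hy0 : y ≠ 0 := fun h0 => hyx (h0 ▸ Submodule.zero_mem _)
    have hxy0 : x + y ≠ 0 := fun h0 => hyx <| by
      rw [eq_neg_of_add_eq_zero_right h0]
      exact Submodule.neg_mem _ (Submodule.mem_span_singleton_self _)
    obtain ⟨a, b, hab⟩ := hline x hx y hy hy0
    obtain ⟨a', b', hab'⟩ := hline y hy x hx hx0
    rw [add_comm y x, ← hab] at hab'
    obtain ⟨p, q, hpq⟩ := Submodule.mem_span_pair.1 (hpair x hx y hy hx0 hy0 (x + y)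
      (H.add_mem hx hy) hxy0 (Submodule.mem_span_pair.2 ⟨1, 1, by rw [one_smul, one_smul]⟩))
    obtain ⟨d, hd⟩ := Submodule.mem_span_singleton.1 (hmem (x + y) (H.add_mem hx hy))
    rw [← hab, ← hpq] at hd
    obtain ⟨e1, e2, e3⟩ := hind x hx y hy hx0 hyx (a' - a) (b' - a) (a' - b) (by
      rw [← sub_eq_zero] at hab'
      rw [← hab']
      simp only [sub_smul, smul_add]
      abel)
    obtain ⟨e4, e5, e6⟩ := hind x hx y hy hx0 hyx (d - a) (d * p - a) (d * q - b) (by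
      rw [← sub_eq_zero] at hd
      rw [← hd]
      simp only [sub_smul, smul_add, mul_smul]
      abel)
    have hda := sub_eq_zero.1 e4
    have hba : b = a := (sub_eq_zero.1 e3).symm.trans (sub_eq_zero.1 e1)
    have ha0 : a ≠ 0 := fun h0 => hh.ne_zero _ (hne _ (H.add_mem hx hy)) <| by
      rw [← hab, hba, h0, zero_smul, zero_smul, add_zero]
    rw [hda] at e5 e6
    rw [hba] at e6
    have hp : p = 1 := mul_left_cancel₀ ha0 (by rw [sub_eq_zero.1 e5, mul_one])
    have hq : q = 1 := mul_left_cancel₀ ha0 (by rw [sub_eq_zero.1 e6, mul_one])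
    rw [← hpq, hp, hq, one_smul, one_smul]
  -- Dependent summands are reduced to independent ones by means of a third vector `z`.
  have hadd_line : ∀ x ∈ H, ∀ p ∈ Submodule.span R {x}, ∀ z ∈ H, z ∉ Submodule.span R {x} →
      l (p + z) = l p + l z := by
    intro x hx p hp z hz hzx
    by_cases hp0 : p = 0
    · rw [hp0, hl0, zero_add, zero_add]
    · have hpH : p ∈ H := (Submodule.span_singleton_le_iff_mem x H).2 hx hp
      refine hadd_ind p hpH z hz hp0 fun hzp => hzx ?_
      exact (Submodule.span_singleton_le_iff_mem p _).2 hp hzp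
  have hadd : ∀ x ∈ H, ∀ y ∈ H, l (x + y) = l x + l y := by
    intro x hx y hy
    by_cases hx0 : x = 0
    · rw [hx0, hl0, zero_add, zero_add]
    by_cases hyx : y ∈ Submodule.span R {x}
    · obtain ⟨z, hz, hzx⟩ := hH x hx
      have hxx := Submodule.mem_span_singleton_self (R := R) x
      have hyz : y + z ∉ Submodule.span R {x} := fun hm =>
        hzx (((Submodule.span R {x}).add_mem_iff_right hyx).1 hm)
      have e1 := hadd_line x hx (x + y) (Submodule.add_mem _ hxx hyx) z hz hzx
      have e2 := hadd_line x hx x hxx (y + z) (H.add_mem hy hz) hyz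
      have e3 := hadd_line x hx y hyx z hz hzx
      rw [e3, ← add_assoc, e1, ← add_assoc] at e2
      exact add_right_cancel e2
    · exact hadd_ind x hx y hy hx0 hyx
  have hscal : ∀ (a : R), ∀ x ∈ H, ∃ s : R', l (a • x) = s • l x := by
    intro a x hx
    by_cases ha : a • x = 0
    · exact ⟨0, by rw [ha, hl0, zero_smul]⟩
    have hx0 : x ≠ 0 := fun h0 => ha (by rw [h0, smul_zero])
    have h1 := hpair x hx x hx hx0 hx0 (a • x) (H.smul_mem a hx) ha
      (Submodule.smul_mem _ _ (Submodule.subset_span (by simp)))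
    rw [Set.pair_eq_singleton] at h1
    obtain ⟨s, hs⟩ := Submodule.mem_span_singleton.1 h1
    exact ⟨s, hs.symm⟩
  obtain ⟨e, he, he'⟩ := hH 0 H.zero_mem
  have he0 : e ≠ 0 := fun h0 => he' (by rw [h0]; exact Submodule.zero_mem _)
  choose s hs using fun a : R => hscal a e he
  have hs_ind : ∀ (a : R), ∀ x ∈ H, x ∉ Submodule.span R {e} → l (a • x) = s a • l x := by
    intro a x hx hxe
    obtain ⟨t, ht⟩ := hscal a x hx
    obtain ⟨u, hu⟩ := hscal a (e + x) (H.add_mem he hx)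
    rw [smul_add, hadd _ (H.smul_mem a he) _ (H.smul_mem a hx), hs, ht, hadd e he x hx] at hu
    obtain ⟨-, e1, e2⟩ := hind e he x hx he0 hxe 0 (s a - u) (t - u) (by
      rw [← sub_eq_zero] at hu
      rw [← hu]
      simp only [sub_smul, smul_add, zero_smul]
      abel)
    rw [ht, sub_eq_zero.1 e2, sub_eq_zero.1 e1]
  have hsmul : ∀ (a : R), ∀ x ∈ H, l (a • x) = s a • l x := by
    intro a x hx
    by_cases hxe : x ∈ Submodule.span R {e}
    · obtain ⟨z, hz, hze⟩ := hH e he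
      have hxz : x + z ∉ Submodule.span R {e} := fun hm =>
        hze (((Submodule.span R {e}).add_mem_iff_right hxe).1 hm)
      have e1 := hs_ind a (x + z) (H.add_mem hx hz) hxz
      rw [smul_add, hadd _ (H.smul_mem a hx) _ (H.smul_mem a hz), hs_ind a z hz hze,
        hadd x hx z hz, smul_add] at e1
      exact add_right_cancel e1
    · exact hs_ind a x hx hxe
  have hle : l e ≠ 0 := (hl e he he0).1
  have hinj : Function.Injective fun c : R' => c • l e := smul_left_injective R' hle
  let σ : R →+* R' :=
    { toFun := s
      map_one' := hinj (by simp only [← hs, one_smul])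
      map_mul' := fun a b => hinj (by
        simp only [← hs, mul_smul]
        rw [hsmul a _ (H.smul_mem b he), hs b])
      map_zero' := hinj (by simp only [← hs, zero_smul, hl0])
      map_add' := fun a b => hinj (by
        simp only [add_smul, ← hs]
        rw [hadd _ (H.smul_mem a he) _ (H.smul_mem b he)]) }
  exact ⟨σ, l, hl0, hadd, hsmul, fun x hx hx0 => (hl x hx hx0).2.1, hmem⟩

/-- The fundamental theorem of projective geometry, in the form needed for maps that are not
surjective: a collineation is induced by a semilinear map. -/
theorem exists_semilinear [FiniteDimensional R V] (hh : IsCollineation R R' h)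
    (hV : 3 ≤ finrank R V) :
    ∃ (σ : R →+* R') (l : V →ₛₗ[σ] W), ∀ x, x ≠ 0 →
      l x ≠ 0 ∧ Submodule.span R' {l x} = Submodule.span R' {h x} := by
  obtain ⟨v, -, hv⟩ := exists_mem_notMem_of_finrank_lt (A := (⊥ : Submodule R V)) (B := ⊤)
    (by rw [finrank_top, finrank_bot]; omega)
  obtain ⟨φ, hφ, -⟩ := Submodule.exists_le_ker_of_notMem hv
  -- Scale the vector, rather than the functional, to obtain `φ x₀ = 1`.
  set x₀ := (φ v)⁻¹ • v
  have hφ₀ : φ x₀ = 1 := by rw [map_smul, smul_eq_mul, inv_mul_cancel₀ hφ]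
  have hx₀ : x₀ ∉ LinearMap.ker φ := fun h0 => one_ne_zero (hφ₀.symm.trans h0)
  have hker := LinearMap.finrank_range_add_finrank_ker φ
  have hrange : finrank R (LinearMap.range φ) ≤ 1 :=
    (Submodule.finrank_le _).trans (finrank_self R).le
  obtain ⟨σ, l, hl0, hadd, hsmul, hspan, hmem⟩ := hh.exists_semilinear_on (LinearMap.ker φ) hx₀
    (fun x _ => exists_mem_notMem_of_finrank_lt
      ((finrank_span_le_card ({x} : Set V)).trans_lt (by simp; omega)))
  have hproj : ∀ x, x - φ x • x₀ ∈ LinearMap.ker φ := fun x => by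
    rw [LinearMap.mem_ker, map_sub, map_smul, hφ₀, smul_eq_mul, mul_one, sub_self]
  let m : V →ₛₗ[σ] W :=
    { toFun := fun x => σ (φ x) • h x₀ + l (x - φ x • x₀)
      map_add' := fun x y => by
        rw [map_add, map_add, add_smul, add_smul,
          show x + y - (φ x • x₀ + φ y • x₀) = (x - φ x • x₀) + (y - φ y • x₀) by abel,
          hadd _ (hproj x) _ (hproj y)]
        abel
      map_smul' := fun a x => by
        rw [map_smul, smul_eq_mul, map_mul, mul_smul, mul_smul, ← smul_sub,
          hsmul _ _ (hproj x), smul_add] }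
  refine ⟨σ, m, fun x hx => ?_⟩
  have hmx : m x = σ (φ x) • h x₀ + l (x - φ x • x₀) := rfl
  have hhx : h x ∈ Submodule.span R' {m x} := by
    by_cases ha : φ x = 0
    · rw [hmx, ha, map_zero, zero_smul, zero_smul, zero_add, sub_zero, ← hspan x ha hx]
      exact Submodule.mem_span_singleton_self _
    · have hy := (LinearMap.ker φ).smul_mem (φ x)⁻¹ (hproj x)
      have hx' : x = φ x • (x₀ + (φ x)⁻¹ • (x - φ x • x₀)) := by
        rw [smul_add, smul_inv_smul₀ ha, add_sub_cancel]
      have hne : x₀ + (φ x)⁻¹ • (x - φ x • x₀) ≠ 0 := fun h0 => hx (by rw [hx', h0, smul_zero])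
      have h1 := hh.mem_span_singleton hne hx
        (Submodule.mem_span_singleton.2 ⟨φ x, hx'.symm⟩)
      rw [span_singleton_eq_of_mem (hh.ne_zero _ hne) (hmem _ hy)] at h1
      have hσ : σ (φ x) ≠ 0 := (map_ne_zero σ).2 ha
      rwa [← Submodule.span_singleton_smul_eq (IsUnit.mk0 _ hσ), smul_add, ← hsmul _ _ hy,
        smul_inv_smul₀ ha] at h1
  have hsp := span_singleton_eq_of_mem (hh.ne_zero x hx) hhx
  refine ⟨fun h0 => hh.ne_zero x hx ?_, hsp.symm⟩
  rw [h0] at hhx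
  simpa using hhx

end IsCollineation

end Collineation

/-! ### Semilinear maps from isometric maps -/

section Representation

variable {R V : Type*} [DivisionRing R] [AddCommGroup V] [Module R V] [FiniteDimensional R V]
  {L : Type*} [Lattice L] {r : L → ℕ} {r₀ k : ℕ} {f g : Submodule R V → L}

/-- The map `g` on points comes from the isometric map `f` on `k`-dimensional subspaces: `f X` is
the least upper bound of the `g P` for `P ≤ X`. Moreover `g` is isometric, and its values have a
common lower bound of rank `r₀`, the star property for the zero subspace. -/
structure IsPointMap (r : L → ℕ) (r₀ k : ℕ) (f g : Submodule R V → L) : Prop where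
  isometric : IsIsometricAt r r₀ k f
  star : IsStarIsometry r r₀ 1 g
  le : ∀ P X : Submodule R V, finrank R P = 1 → finrank R X = k → P ≤ X → g P ≤ f X
  le_of_forall : ∀ (X : Submodule R V) (t : L), finrank R X = k →
    (∀ P ≤ X, finrank R P = 1 → g P ≤ t) → f X ≤ t

namespace IsPointMap

/-- Two `k`-dimensional subspaces meeting exactly in the line `P ⊔ Q` bound the images of its
points. -/
theorem le_sup (hr : IsRank r) (hk : 2 ≤ k) (hn : 2 * k ≤ finrank R V)
    (hg : IsPointMap r r₀ k f g) {P Q T : Submodule R V} (hP : finrank R P = 1)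
    (hQ : finrank R Q = 1) (hT : finrank R T = 1) (h : T ≤ P ⊔ Q) : g T ≤ g P ⊔ g Q := by
  by_cases hPQ : P = Q
  · subst hPQ
    rw [sup_idem] at h
    rw [Submodule.eq_of_le_of_finrank_eq h (hT.trans hP.symm)]
    exact le_sup_left
  have h1 := finrank_inf_lt_of_ne (hP.trans hQ.symm) hPQ
  have h2 := Submodule.finrank_sup_add_finrank_inf_eq P Q
  obtain ⟨X, Y, hX', hY', hX, hY, hXY⟩ := exists_extensions (A := P ⊔ Q) (B := P ⊔ Q)
    (a := k) (b := k) (by omega) (by omega) (by omega)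
  rw [inf_idem] at hXY
  have h3 := hg.isometric X Y hX hY
  rw [hXY] at h3
  have h4 : g P ⊔ g Q ≤ f X ⊓ f Y :=
    sup_le (le_inf (hg.le P X hP hX (le_sup_left.trans hX'))
      (hg.le P Y hP hY (le_sup_left.trans hY')))
      (le_inf (hg.le Q X hQ hX (le_sup_right.trans hX'))
      (hg.le Q Y hQ hY (le_sup_right.trans hY')))
  have h5 := hr.sup_add_inf (g P) (g Q)
  rw [hg.star.isometric P Q hP hQ, hg.star.isometric.rank_eq hP,
    hg.star.isometric.rank_eq hQ] at h5
  rw [hr.eq_of_le h4 (by omega)]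
  exact le_inf (hg.le T X hT hX (h.trans hX')) (hg.le T Y hT hY (h.trans hY'))

theorem not_le_sup (hr : IsRank r) (hk : 2 ≤ k) (hn : 2 * k ≤ finrank R V)
    (hg : IsPointMap r r₀ k f g) {P Q T : Submodule R V} (hP : finrank R P = 1)
    (hQ : finrank R Q = 1) (hT : finrank R T = 1) (h : ¬ T ≤ P ⊔ Q) : ¬ g T ≤ g P ⊔ g Q := by
  intro hle
  have h2 := Submodule.finrank_sup_add_finrank_inf_eq P Q
  obtain ⟨X, Y, hX', hY', hX, hY, hXY⟩ := exists_extensions (A := P ⊔ Q) (B := T)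
    (a := k) (b := k) (by omega) (by omega) (by omega)
  have h3 := hg.isometric X Y hX hY
  have h4 : finrank R ↥((P ⊔ Q) ⊓ T) < finrank R T :=
    Submodule.finrank_lt_finrank_of_lt (lt_of_le_of_ne inf_le_right fun he => h (inf_eq_right.1 he))
  have h5 : g T ≤ f X ⊓ f Y := le_inf
    (hle.trans (sup_le (hg.le P X hP hX (le_sup_left.trans hX'))
      (hg.le Q X hQ hX (le_sup_right.trans hX')))) (hg.le T Y hT hY hY')
  have h6 := hr.mono h5
  rw [hg.star.isometric.rank_eq hT, h3, hXY] at h6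
  omega

/-- The bound is `f X ⊔ f Y` for complementary `X`, `Y`: each further point is on a line joining a
point of `X` and a point of `Y`. -/
theorem exists_upper_bound (hr : IsRank r) (hk : 2 ≤ k) (hn : finrank R V = 2 * k)
    (hg : IsPointMap r r₀ k f g) :
    ∃ t, r t = r₀ + 2 * k ∧ ∀ P : Submodule R V, finrank R P = 1 → g P ≤ t := by
  obtain ⟨X, Y, -, -, hX, hY, hXY⟩ := exists_extensions (A := (⊥ : Submodule R V)) (B := ⊥)
    (a := k) (b := k) (by rw [finrank_bot]; omega) (by rw [finrank_bot]; omega) (by omega)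
  rw [inf_idem] at hXY
  have h1 := Submodule.finrank_sup_add_finrank_inf_eq X Y
  have h2 := hg.isometric X Y hX hY
  rw [hXY, finrank_bot] at h1 h2
  have h3 := hr.sup_add_inf (f X) (f Y)
  rw [hg.isometric.rank_eq hX, hg.isometric.rank_eq hY] at h3
  have htop : X ⊔ Y = ⊤ := Submodule.eq_top_of_finrank_eq (by omega)
  refine ⟨f X ⊔ f Y, by omega, fun P hP => ?_⟩
  obtain ⟨v, hv, hv0⟩ := exists_mem_notMem_of_finrank_lt (A := (⊥ : Submodule R V)) (B := P)
    (by rw [finrank_bot]; omega)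
  have hv0' : v ≠ 0 := fun h => hv0 (h ▸ Submodule.zero_mem _)
  have hPv : R ∙ v = P := Submodule.eq_of_le_of_finrank_eq
    ((Submodule.span_singleton_le_iff_mem v P).2 hv) (by rw [finrank_span_singleton hv0', hP])
  obtain ⟨x, hx, y, hy, rfl⟩ := Submodule.mem_sup.1 (htop.ge (Submodule.mem_top (x := v)))
  have hgX : ∀ x ∈ X, x ≠ 0 → g (R ∙ x) ≤ f X ⊔ f Y := fun x hx hx0 =>
    (hg.le _ X (finrank_span_singleton hx0) hX
      ((Submodule.span_singleton_le_iff_mem x X).2 hx)).trans le_sup_left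
  have hgY : ∀ y ∈ Y, y ≠ 0 → g (R ∙ y) ≤ f X ⊔ f Y := fun y hy hy0 =>
    (hg.le _ Y (finrank_span_singleton hy0) hY
      ((Submodule.span_singleton_le_iff_mem y Y).2 hy)).trans le_sup_right
  by_cases hx0 : x = 0
  · subst hx0
    rw [zero_add] at hPv hv0'
    rw [← hPv]
    exact hgY y hy hv0'
  by_cases hy0 : y = 0
  · subst hy0
    rw [add_zero] at hPv hv0'
    rw [← hPv]
    exact hgX x hx hv0'
  refine (hg.le_sup hr hk hn.ge (finrank_span_singleton hx0) (finrank_span_singleton hy0) hP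
    ?_).trans (sup_le (hgX x hx hx0) (hgY y hy hy0))
  rw [← hPv, Submodule.span_singleton_le_iff_mem]
  exact Submodule.add_mem_sup (Submodule.mem_span_singleton_self x)
    (Submodule.mem_span_singleton_self y)

/-- If the subspaces of `W` represent, through `e`, a part of the lattice containing the images of
all points, then the map is induced by a semilinear map into `W`. -/
theorem exists_semilinear {R' W : Type*} [DivisionRing R'] [AddCommGroup W] [Module R' W]
    [FiniteDimensional R' W] (hr : IsRank r) (hk : 2 ≤ k) (hn : 2 * k ≤ finrank R V)
    (hg : IsPointMap r r₀ k f g) (e : Submodule R' W → L)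
    (he_rank : ∀ a, r (e a) = r₀ + finrank R' a) (he_sup : ∀ a b, e (a ⊔ b) = e a ⊔ e b)
    (he_range : ∀ P : Submodule R V, finrank R P = 1 → ∃ a, e a = g P) :
    ∃ (σ : R →+* R') (l : V →ₛₗ[σ] W), IsSemilinearMEmbedding (2 * k) l ∧
      ∀ X : Submodule R V, finrank R X = k → f X = e (spanImage l X) := by
  classical
  have he_mono : ∀ {a b}, a ≤ b → e a ≤ e b := fun {a b} hab => by
    rw [← sup_eq_right.2 hab, he_sup]; exact le_sup_left
  have he_le : ∀ {a b}, e a ≤ e b → a ≤ b := fun {a b} hab => by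
    have h1 := he_rank (a ⊔ b)
    rw [he_sup, sup_eq_right.2 hab, he_rank] at h1
    rw [Submodule.eq_of_le_of_finrank_eq (le_sup_right : b ≤ a ⊔ b) (by omega)]
    exact le_sup_left
  have hrep : ∀ v : V, ∃ w : W, v ≠ 0 → w ≠ 0 ∧ e (R' ∙ w) = g (R ∙ v) := by
    intro v
    by_cases hv : v = 0
    · exact ⟨0, fun h => absurd hv h⟩
    obtain ⟨a, ha⟩ := he_range (R ∙ v) (finrank_span_singleton hv)
    have h1 := he_rank a
    rw [ha, hg.star.isometric.rank_eq (finrank_span_singleton hv)] at h1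
    obtain ⟨w, hw, hw0⟩ := exists_mem_notMem_of_finrank_lt (A := (⊥ : Submodule R' W)) (B := a)
      (by rw [finrank_bot]; omega)
    have hw0' : w ≠ 0 := fun h => hw0 (h ▸ Submodule.zero_mem _)
    refine ⟨w, fun _ => ⟨hw0', ?_⟩⟩
    rw [Submodule.eq_of_le_of_finrank_eq ((Submodule.span_singleton_le_iff_mem w a).2 hw)
      (by rw [finrank_span_singleton hw0']; omega), ha]
  choose h hh using hrep
  have hcoll : IsCollineation R R' h := by
    have hpair : ∀ {x y z}, x ≠ 0 → y ≠ 0 → z ≠ 0 →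
        (h z ∈ Submodule.span R' {h x, h y} ↔ g (R ∙ z) ≤ g (R ∙ x) ⊔ g (R ∙ y)) := by
      intro x y z hx hy hz
      rw [← Submodule.span_singleton_le_iff_mem, ← (hh x hx).2, ← (hh y hy).2, ← (hh z hz).2,
        ← he_sup, Submodule.span_insert]
      exact ⟨he_mono, he_le⟩
    have hnot : ∀ {x y z}, x ≠ 0 → y ≠ 0 → z ∉ Submodule.span R {x, y} →
        h z ∉ Submodule.span R' {h x, h y} := by
      intro x y z hx hy hzxy
      have hz : z ≠ 0 := fun h0 => hzxy (h0 ▸ Submodule.zero_mem _)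
      rw [hpair hx hy hz]
      refine hg.not_le_sup hr hk hn (finrank_span_singleton hx) (finrank_span_singleton hy)
        (finrank_span_singleton hz) ?_
      rwa [← Submodule.span_insert, Submodule.span_singleton_le_iff_mem]
    refine ⟨fun x hx => (hh x hx).1, fun x y z hx hy hz hzxy => ?_, fun x y hx hyx => ?_,
      fun x y z hx hyx hzxy => hnot hx (fun h0 => hyx (h0 ▸ Submodule.zero_mem _)) hzxy⟩
    · rw [hpair hx hy hz]
      refine hg.le_sup hr hk hn (finrank_span_singleton hx) (finrank_span_singleton hy)
        (finrank_span_singleton hz) ?_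
      rwa [← Submodule.span_insert, Submodule.span_singleton_le_iff_mem]
    · have := hnot (x := x) (y := x) (z := y) hx hx (by simpa using hyx)
      simpa using this
  obtain ⟨σ, l, hl⟩ := hcoll.exists_semilinear (by omega)
  have hel : ∀ x, x ≠ 0 → e (R' ∙ l x) = g (R ∙ x) := fun x hx => by
    rw [(hl x hx).2, (hh x hx).2]
  have hle : ∀ (X : Submodule R V) (a : Submodule R' W), finrank R X = k → (∀ x ∈ X, l x ∈ a) →
      f X ≤ e a := by
    intro X a hX hXa
    refine hg.le_of_forall X (e a) hX fun P hPX hP => ?_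
    obtain ⟨v, hv, hv0⟩ := exists_mem_notMem_of_finrank_lt (A := (⊥ : Submodule R V)) (B := P)
      (by rw [finrank_bot]; omega)
    have hv0' : v ≠ 0 := fun h => hv0 (h ▸ Submodule.zero_mem _)
    have hPv : R ∙ v = P := Submodule.eq_of_le_of_finrank_eq
      ((Submodule.span_singleton_le_iff_mem v P).2 hv) (by rw [finrank_span_singleton hv0', hP])
    rw [← hPv, ← hel v hv0']
    exact he_mono ((Submodule.span_singleton_le_iff_mem _ _).2 (hXa v (hPX hv)))
  have hspan : ∀ {ι : Type} [Fintype ι] (v : ι → V), ∀ x ∈ Submodule.span R (Set.range v),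
      l x ∈ Submodule.span R' (Set.range (fun i => l (v i))) := by
    intro ι _ v x hx
    have : Submodule.span R (Set.range v) ≤
        (Submodule.span R' (Set.range (fun i => l (v i)))).comap l := by
      rw [Submodule.span_le]
      rintro _ ⟨i, rfl⟩
      exact Submodule.subset_span ⟨i, rfl⟩
    exact this hx
  refine ⟨σ, l, ⟨?_, fun v hv => ?_⟩, fun X hX => ?_⟩
  · refine (injective_iff_map_eq_zero l).2 fun x hx => ?_
    by_contra h0
    exact (hl x h0).1 hx
  · -- Two complementary `k`-dimensional subspaces `X`, `Y` of the span of the vectors.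
    set a := Submodule.span R' (Set.range (fun i => l (v i)))
    have hV := finrank_span_eq_card hv
    rw [Fintype.card_fin] at hV
    obtain ⟨X, -, hXv, hX⟩ := exists_finrank_eq_between
      (bot_le : ⊥ ≤ Submodule.span R (Set.range v)) (m := k) (by rw [finrank_bot]; omega)
      (by omega)
    obtain ⟨Y', hY'⟩ := exists_isCompl X
    have hXY' := Submodule.finrank_add_eq_of_isCompl hY'
    have h1 := Submodule.finrank_sup_add_finrank_inf_eq Y' (Submodule.span R (Set.range v))
    have h2 := Submodule.finrank_le (Y' ⊔ Submodule.span R (Set.range v))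
    obtain ⟨Y, -, hYv, hY⟩ := exists_finrank_eq_between
      (bot_le : ⊥ ≤ Y' ⊓ Submodule.span R (Set.range v)) (m := k) (by rw [finrank_bot]; omega)
      (by omega)
    have hXY : X ⊓ Y = ⊥ := le_bot_iff.1
      ((inf_le_inf_left X (hYv.trans inf_le_left)).trans hY'.disjoint.le_bot)
    have h3 := hle X a hX fun x hx => hspan v x (hXv hx)
    have h4 := hle Y a hY fun x hx => hspan v x ((hYv.trans inf_le_right) hx)
    have h5 := hr.mono (_root_.sup_le h3 h4)
    have h6 := hr.sup_add_inf (f X) (f Y)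
    rw [hg.isometric X Y hX hY, hXY, finrank_bot, hg.isometric.rank_eq hX,
      hg.isometric.rank_eq hY] at h6
    rw [he_rank] at h5
    rw [linearIndependent_iff_card_le_finrank_span, Fintype.card_fin]
    change 2 * k ≤ finrank R' a
    omega
  · have h1 : f X ≤ e (spanImage l X) := hle X _ hX fun x hx =>
      Submodule.subset_span ⟨x, hx, rfl⟩
    refine hr.eq_of_le h1 ?_
    -- The span of the image of a basis of `X` has dimension at most `k`.
    let b := Module.finBasis R X
    have h2 : spanImage l X ≤ Submodule.span R' (Set.range (fun i => l (b i : V))) := by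
      refine Submodule.span_le.2 ?_
      rintro _ ⟨x, hx, rfl⟩
      refine hspan (fun i => (b i : V)) x ?_
      have h3 := Submodule.mem_map_of_mem (f := X.subtype) (b.mem_span ⟨x, hx⟩)
      rw [Submodule.map_span, ← Set.range_comp] at h3
      exact h3
    have h4 : finrank R' (Submodule.span R' (Set.range (fun i => l (b i : V)))) ≤
        Fintype.card (Fin (finrank R X)) :=
      finrank_range_le_card (R := R') (fun i => l (b i : V))
    rw [Fintype.card_fin] at h4
    have h5 := Submodule.finrank_mono h2
    rw [he_rank, hg.isometric.rank_eq hX]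
    omega

end IsPointMap

theorem IsStarIsometry.exists_isPointMap (hr : IsRank r) (hk : 1 ≤ k) (hn : 2 * k ≤ finrank R V)
    (hf : IsStarIsometry r r₀ k f) :
    ∃ (g : Submodule R V → L) (s : L), IsPointMap r r₀ k f g ∧ r s = r₀ ∧
      ∀ P : Submodule R V, finrank R P = 1 → s ≤ g P := by
  obtain ⟨j, rfl⟩ : ∃ j, k = j + 1 := ⟨k - 1, by omega⟩
  obtain ⟨g, hg, h1, h2⟩ := hf.exists_points hr hn
  obtain ⟨s, hs, hsP⟩ := hg.star ⊥ (by rw [finrank_bot])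
  exact ⟨g, s, ⟨hf.isometric, hg, h1, h2⟩, by omega, fun P hP => hsP P bot_le hP⟩

end Representation

/-! ### Annihilators over division rings -/

section Annihilator

variable {R W : Type*} [DivisionRing R] [AddCommGroup W] [Module R W]

theorem annihilator_sup (Φ Ψ : Submodule Rᵐᵒᵖ (Module.Dual R W)) :
    annihilator (Φ ⊔ Ψ) = annihilator Φ ⊓ annihilator Ψ := by
  ext x
  refine ⟨fun h => ⟨fun φ hφ => h φ (Submodule.mem_sup_left hφ),
    fun φ hφ => h φ (Submodule.mem_sup_right hφ)⟩, fun h φ hφ => ?_⟩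
  obtain ⟨α, hα, β, hβ, rfl⟩ := Submodule.mem_sup.1 hφ
  rw [LinearMap.add_apply, h.1 α hα, h.2 β hβ, add_zero]

theorem exists_annihilator_eq (Y : Submodule R W) :
    ∃ Φ : Submodule Rᵐᵒᵖ (Module.Dual R W), annihilator Φ = Y := by
  refine ⟨
    { carrier := {φ | ∀ y ∈ Y, φ y = 0}
      add_mem' := fun {a b} ha hb y hy => by rw [LinearMap.add_apply, ha y hy, hb y hy, add_zero]
      zero_mem' := fun y _ => rfl
      smul_mem' := fun c φ hφ y hy => by rw [LinearMap.smul_apply, hφ y hy, smul_zero] }, ?_⟩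
  refine le_antisymm (fun x hx => ?_) fun x hx φ hφ => hφ x hx
  by_contra hxY
  obtain ⟨φ, hφx, hφY⟩ := Submodule.exists_le_ker_of_notMem hxY
  exact hφx (hx φ fun y hy => hφY hy)

theorem finrank_mulOpposite_self : finrank Rᵐᵒᵖ R = 1 :=
  finrank_eq_one (1 : R) one_ne_zero fun w =>
    ⟨MulOpposite.op w, by rw [op_smul_eq_mul, one_mul]⟩

instance finite_mulOpposite_self : Module.Finite Rᵐᵒᵖ R :=
  Module.finite_of_finrank_eq_succ finrank_mulOpposite_self

theorem finrank_mulOpposite_fun (m : ℕ) : finrank Rᵐᵒᵖ (Fin m → R) = m := by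
  rw [Module.finrank_pi_fintype]
  simp [finrank_mulOpposite_self]

/-- Functionals vanishing on `Y` are determined by their values on a basis of `W` modulo `Y`. -/
theorem exists_injective_of_annihilator [FiniteDimensional R W]
    (Φ : Submodule Rᵐᵒᵖ (Module.Dual R W)) :
    ∃ T : Φ →ₗ[Rᵐᵒᵖ] (Fin (finrank R (W ⧸ annihilator Φ)) → R), Function.Injective T := by
  let b := Module.finBasis R (W ⧸ annihilator Φ)
  choose w hw using fun i => (annihilator Φ).mkQ_surjective (b i)
  let T : Φ →ₗ[Rᵐᵒᵖ] (Fin (finrank R (W ⧸ annihilator Φ)) → R) :=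
    { toFun := fun φ i => φ.1 (w i)
      map_add' := fun _ _ => rfl
      map_smul' := fun _ _ => rfl }
  refine ⟨T, fun φ ψ hφψ => ?_⟩
  have hker : annihilator Φ ≤ LinearMap.ker (φ.1 - ψ.1) := fun x hx => by
    rw [LinearMap.mem_ker, LinearMap.sub_apply, hx φ.1 φ.2, hx ψ.1 ψ.2, sub_zero]
  have h0 : (annihilator Φ).liftQ (φ.1 - ψ.1) hker = 0 := b.ext fun i => by
    rw [← hw i, Submodule.mkQ_apply, Submodule.liftQ_apply, LinearMap.sub_apply]
    exact sub_eq_zero.2 (congrFun hφψ i)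
  ext x
  have h1 := LinearMap.congr_fun h0 ((annihilator Φ).mkQ x)
  rw [Submodule.mkQ_apply, Submodule.liftQ_apply, LinearMap.sub_apply] at h1
  exact sub_eq_zero.1 h1

instance finite_dual [FiniteDimensional R W] : Module.Finite Rᵐᵒᵖ (Module.Dual R W) := by
  obtain ⟨T, hT⟩ := exists_injective_of_annihilator (⊤ : Submodule Rᵐᵒᵖ (Module.Dual R W))
  have : Module.Finite Rᵐᵒᵖ (⊤ : Submodule Rᵐᵒᵖ (Module.Dual R W)) :=
    Module.Finite.of_injective T hT
  exact Module.Finite.equiv (Submodule.topEquiv (R := Rᵐᵒᵖ) (M := Module.Dual R W))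

theorem exists_span_range_eq {Q D : Type*} [DivisionRing Q] [AddCommGroup D] [Module Q D]
    [FiniteDimensional Q D] (Φ : Submodule Q D) :
    ∃ b : Fin (finrank Q Φ) → D, Submodule.span Q (Set.range b) = Φ := by
  refine ⟨fun i => (Module.finBasis Q Φ i : D), ?_⟩
  have h := congrArg (Submodule.map Φ.subtype) (Module.finBasis Q Φ).span_eq
  rwa [Submodule.map_span, ← Set.range_comp, Submodule.map_top, Submodule.range_subtype] at h

theorem finrank_annihilator_add [FiniteDimensional R W]
    (Φ : Submodule Rᵐᵒᵖ (Module.Dual R W)) :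
    finrank R (annihilator Φ) + finrank Rᵐᵒᵖ Φ = finrank R W := by
  obtain ⟨T, hT⟩ := exists_injective_of_annihilator Φ
  have h2 := LinearMap.finrank_le_finrank_of_injective hT
  rw [finrank_mulOpposite_fun] at h2
  have h3 := Submodule.finrank_quotient_add_finrank (annihilator Φ)
  -- The annihilator is the common kernel of the functionals spanning `Φ`.
  obtain ⟨b, hb⟩ := exists_span_range_eq Φ
  let E : W →ₗ[R] (Fin (finrank Rᵐᵒᵖ Φ) → R) := LinearMap.pi b
  have hE : LinearMap.ker E ≤ annihilator Φ := by
    intro x hx φ hφ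
    rw [← hb] at hφ
    induction hφ using Submodule.span_induction with
    | mem φ h =>
      obtain ⟨i, rfl⟩ := h
      exact congrFun hx i
    | zero => rfl
    | add α β _ _ hα hβ => rw [LinearMap.add_apply, hα, hβ, add_zero]
    | smul c α _ hα => rw [LinearMap.smul_apply, hα, smul_zero]
  have h6 := LinearMap.finrank_range_add_finrank_ker E
  have h7 := Submodule.finrank_mono hE
  have h8 := Submodule.finrank_le (LinearMap.range E)
  rw [Module.finrank_fin_fun] at h8
  omega

end Annihilator

/-! ### Subspaces between two subspaces -/

section Interval

variable {R W W' : Type*} [DivisionRing R] [AddCommGroup W] [Module R W]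
  [AddCommGroup W'] [Module R W']

theorem comap_sup_of_surjective (q : W →ₗ[R] W') (hq : Function.Surjective q)
    (a b : Submodule R W') : (a ⊔ b).comap q = a.comap q ⊔ b.comap q := by
  refine le_antisymm (fun x hx => ?_)
    (sup_le (Submodule.comap_mono le_sup_left) (Submodule.comap_mono le_sup_right))
  obtain ⟨y, hy, z, hz, hyz⟩ := Submodule.mem_sup.1 (Submodule.mem_comap.1 hx)
  obtain ⟨y', rfl⟩ := hq y
  refine Submodule.mem_sup.2 ⟨y', hy, x - y', ?_, add_sub_cancel _ _⟩
  rw [Submodule.mem_comap, map_sub, ← hyz, add_sub_cancel_left]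
  exact hz

theorem finrank_comap_mkQ [FiniteDimensional R W] (S : Submodule R W) (a : Submodule R (W ⧸ S)) :
    finrank R (a.comap S.mkQ) = finrank R S + finrank R a := by
  have h1 := LinearMap.finrank_range_add_finrank_ker (a.mkQ ∘ₗ S.mkQ)
  rw [LinearMap.range_eq_top.2 (by
      rw [LinearMap.coe_comp]; exact a.mkQ_surjective.comp S.mkQ_surjective),
    LinearMap.ker_comp, Submodule.ker_mkQ, finrank_top] at h1
  have h2 := Submodule.finrank_quotient_add_finrank a
  have h3 := Submodule.finrank_quotient_add_finrank S
  omega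

theorem exists_comap_mkQ_eq {S P : Submodule R W} (h : S ≤ P) :
    ∃ a : Submodule R (W ⧸ S), a.comap S.mkQ = P :=
  ⟨P.map S.mkQ, by rw [Submodule.comap_map_mkQ, sup_eq_right.2 h]⟩

theorem exists_map_subtype_eq {U P : Submodule R W} (h : P ≤ U) :
    ∃ a : Submodule R U, a.map U.subtype = P :=
  ⟨P.comap U.subtype, by rw [Submodule.map_comap_subtype, inf_eq_right.2 h]⟩

theorem liftSubquot_sup (S U : Submodule R W) (a b : Submodule R (Subquot S U)) :
    liftSubquot S U (a ⊔ b) = liftSubquot S U a ⊔ liftSubquot S U b := by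
  rw [liftSubquot, comap_sup_of_surjective _ (Submodule.mkQ_surjective _), Submodule.map_sup]
  rfl

theorem liftSubquot_inf (S U : Submodule R W) (a b : Submodule R (Subquot S U)) :
    liftSubquot S U (a ⊓ b) = liftSubquot S U a ⊓ liftSubquot S U b := by
  rw [liftSubquot, Submodule.comap_inf, Submodule.map_inf _ U.injective_subtype]
  rfl

theorem finrank_submoduleOf {S U : Submodule R W} (h : S ≤ U) :
    finrank R (S.submoduleOf U) = finrank R S := by
  rw [← Submodule.finrank_map_subtype_eq U, Submodule.submoduleOf, Submodule.map_comap_subtype,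
    inf_eq_right.2 h]

theorem finrank_liftSubquot [FiniteDimensional R W] {S U : Submodule R W} (h : S ≤ U)
    (a : Submodule R (Subquot S U)) :
    finrank R (liftSubquot S U a) = finrank R S + finrank R a := by
  rw [liftSubquot, Submodule.finrank_map_subtype_eq, finrank_comap_mkQ, finrank_submoduleOf h]

theorem finrank_subquot_add [FiniteDimensional R W] {S U : Submodule R W} (h : S ≤ U) :
    finrank R (Subquot S U) + finrank R S = finrank R U := by
  rw [← finrank_submoduleOf h]
  exact Submodule.finrank_quotient_add_finrank _

theorem exists_liftSubquot_eq {S U P : Submodule R W} (hS : S ≤ P) (hU : P ≤ U) :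
    ∃ a : Submodule R (Subquot S U), liftSubquot S U a = P := by
  obtain ⟨b, hb⟩ := exists_map_subtype_eq hU
  obtain ⟨a, ha⟩ := exists_comap_mkQ_eq (S := S.submoduleOf U) (P := b) (by
    rintro x hx
    have : (x : W) ∈ b.map U.subtype := hb.ge (hS hx)
    obtain ⟨y, hy, hyx⟩ := this
    rwa [← Subtype.ext hyx])
  exact ⟨a, by rw [liftSubquot, ha, hb]⟩

end Interval

/-! ### The lattice of subspaces and its dual as ranked lattices -/

section Ranked

variable (R W : Type*) [DivisionRing R] [AddCommGroup W] [Module R W] [FiniteDimensional R W]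

theorem isRank_finrank : IsRank fun X : Submodule R W => finrank R X :=
  ⟨Submodule.finrank_strictMono, fun X Y => Submodule.finrank_sup_add_finrank_inf_eq X Y⟩

/-- The codimension of a subspace, as a function on the dual of the lattice of subspaces. -/
noncomputable def codim (X : (Submodule R W)ᵒᵈ) : ℕ :=
  finrank R W - finrank R (OrderDual.ofDual X : Submodule R W)

variable {R W} in
theorem codim_add (X : (Submodule R W)ᵒᵈ) :
    codim R W X + finrank R (OrderDual.ofDual X : Submodule R W) = finrank R W :=
  Nat.sub_add_cancel (Submodule.finrank_le _)

theorem isRank_codim : IsRank (codim R W) := by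
  refine ⟨fun X Y h => ?_, fun X Y => ?_⟩
  · have h1 : finrank R (OrderDual.ofDual Y : Submodule R W) <
        finrank R (OrderDual.ofDual X : Submodule R W) :=
      Submodule.finrank_lt_finrank_of_lt h
    have h2 := codim_add X
    have h3 := codim_add Y
    omega
  · have h1 := Submodule.finrank_sup_add_finrank_inf_eq
      (OrderDual.ofDual X : Submodule R W) (OrderDual.ofDual Y)
    have h2 := codim_add X
    have h3 := codim_add Y
    have h4 := codim_add (X ⊔ Y)
    have h5 := codim_add (X ⊓ Y)
    rw [ofDual_sup] at h4
    rw [ofDual_inf] at h5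
    omega

end Ranked

/-! ### Embeddings that send stars into stars, and into tops -/

section Types

variable {R R' V V' : Type*} [DivisionRing R] [DivisionRing R'] [AddCommGroup V] [Module R V]
  [FiniteDimensional R V] [AddCommGroup V'] [Module R' V'] [FiniteDimensional R' V'] {k r₀ : ℕ}
  {f : Submodule R V → Submodule R' V'}

/-- The case of stars sent into stars. -/
theorem exists_semilinear_of_star (hk : 2 ≤ k) (hn : 2 * k ≤ finrank R V)
    (hf : IsStarIsometry (fun X : Submodule R' V' => finrank R' X) r₀ k f) :
    (∃ S : Submodule R' V', finrank R' S = r₀ ∧ ∃ (σ : R →+* R') (l : V →ₛₗ[σ] (V' ⧸ S)),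
      IsSemilinearMEmbedding (2 * k) l ∧
      ∀ X : Submodule R V, finrank R X = k → f X = (spanImage l X).comap S.mkQ) ∧
    (finrank R V = 2 * k → ∃ S U : Submodule R' V', S ≤ U ∧ finrank R' S = r₀ ∧
      finrank R' U = r₀ + 2 * k ∧ ∃ (σ : R →+* R') (l : V →ₛₗ[σ] Subquot S U),
        IsSemilinearEmbedding l ∧
        ∀ X : Submodule R V, finrank R X = k → f X = liftSubquot S U (spanImage l X)) := by
  have hr := isRank_finrank R' V'
  obtain ⟨g, S, hg, hS, hSg⟩ := hf.exists_isPointMap hr (by omega) hn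
  refine ⟨⟨S, hS, ?_⟩, fun hn' => ?_⟩
  · exact hg.exists_semilinear hr hk hn (fun a => a.comap S.mkQ)
      (fun a => by rw [finrank_comap_mkQ, hS])
      (comap_sup_of_surjective _ S.mkQ_surjective)
      fun P hP => exists_comap_mkQ_eq (hSg P hP)
  · obtain ⟨U, hU, hgU⟩ := hg.exists_upper_bound hr hk hn'
    obtain ⟨P, -, -, hP⟩ := exists_finrank_eq_between (bot_le : (⊥ : Submodule R V) ≤ ⊤) (m := 1)
      (by rw [finrank_bot]; omega) (by rw [finrank_top]; omega)
    have hSU : S ≤ U := (hSg P hP).trans (hgU P hP)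
    obtain ⟨σ, l, hl, hlX⟩ := hg.exists_semilinear hr hk hn (liftSubquot S U)
      (fun a => by rw [finrank_liftSubquot hSU, hS]) (liftSubquot_sup S U)
      fun P hP => exists_liftSubquot_eq (hSg P hP) (hgU P hP)
    refine ⟨S, U, hSU, hS, hU, σ, l, ⟨?_, ?_⟩, hlX⟩
    · have := finrank_subquot_add hSU
      omega
    · rwa [hn']

/-- The case of stars sent into tops, which are the stars of the dual lattice. -/
theorem exists_semilinear_of_costar (hk : 2 ≤ k) (hn : 2 * k ≤ finrank R V)
    (hf : IsStarIsometry (codim R' V') r₀ k (fun X => OrderDual.toDual (f X))) :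
    (∃ U : Submodule R' V', finrank R' U + r₀ = finrank R' V' ∧
      ∃ (σ : R →+* R'ᵐᵒᵖ) (l : V →ₛₗ[σ] Module.Dual R' U),
      IsSemilinearMEmbedding (2 * k) l ∧
      ∀ X : Submodule R V, finrank R X = k →
        f X = (annihilator (spanImage l X)).map U.subtype) ∧
    (finrank R V = 2 * k → ∃ S U : Submodule R' V', S ≤ U ∧
      finrank R' U + r₀ = finrank R' V' ∧ finrank R' S + 2 * k = finrank R' U ∧
      ∃ (σ : R →+* R'ᵐᵒᵖ) (l : V →ₛₗ[σ] Module.Dual R' (Subquot S U)),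
        IsSemilinearEmbedding l ∧
        ∀ X : Submodule R V, finrank R X = k →
          f X = liftSubquot S U (annihilator (spanImage l X))) := by
  have hr := isRank_codim R' V'
  obtain ⟨g, U', hg, hU, hUg⟩ := hf.exists_isPointMap hr (by omega) hn
  obtain ⟨U, rfl⟩ := OrderDual.toDual.surjective U'
  have hU' : r₀ + finrank R' U = finrank R' V' := hU ▸ codim_add (OrderDual.toDual U)
  refine ⟨⟨U, by omega, ?_⟩, fun hn' => ?_⟩
  · obtain ⟨σ, l, hl, hlX⟩ := hg.exists_semilinear (R' := R'ᵐᵒᵖ) (W := Module.Dual R' U) hr hk hn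
      (fun a => OrderDual.toDual ((annihilator a).map U.subtype))
      (fun a => by
        have h1 := codim_add (OrderDual.toDual ((annihilator a).map U.subtype))
        rw [OrderDual.ofDual_toDual, Submodule.finrank_map_subtype_eq] at h1
        have h2 := finrank_annihilator_add a
        omega)
      (fun a b => by
        rw [annihilator_sup, Submodule.map_inf _ U.injective_subtype, toDual_inf])
      fun P hP => by
        obtain ⟨b, hb⟩ := exists_map_subtype_eq
          (show (OrderDual.ofDual (g P) : Submodule R' V') ≤ U from hUg P hP)
        obtain ⟨Φ, hΦ⟩ := exists_annihilator_eq b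
        exact ⟨Φ, by rw [hΦ, hb, OrderDual.toDual_ofDual]⟩
    exact ⟨σ, l, hl, hlX⟩
  · obtain ⟨S', hS, hgS⟩ := hg.exists_upper_bound hr hk hn'
    obtain ⟨S, rfl⟩ := OrderDual.toDual.surjective S'
    have hS' : r₀ + 2 * k + finrank R' S = finrank R' V' := hS ▸ codim_add (OrderDual.toDual S)
    obtain ⟨P, -, -, hP⟩ := exists_finrank_eq_between (bot_le : (⊥ : Submodule R V) ≤ ⊤) (m := 1)
      (by rw [finrank_bot]; omega) (by rw [finrank_top]; omega)
    have hSU : S ≤ U := OrderDual.toDual_le_toDual.1 ((hUg P hP).trans (hgS P hP))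
    have hsub := finrank_subquot_add hSU
    obtain ⟨σ, l, hl, hlX⟩ := hg.exists_semilinear (R' := R'ᵐᵒᵖ)
      (W := Module.Dual R' (Subquot S U)) hr hk hn
      (fun a => OrderDual.toDual (liftSubquot S U (annihilator a)))
      (fun a => by
        have h1 := codim_add (OrderDual.toDual (liftSubquot S U (annihilator a)))
        rw [OrderDual.ofDual_toDual, finrank_liftSubquot hSU] at h1
        have h2 := finrank_annihilator_add a
        omega)
      (fun a b => by rw [annihilator_sup, liftSubquot_inf, toDual_inf])
      fun P hP => by
        obtain ⟨b, hb⟩ := exists_liftSubquot_eq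
          (show S ≤ (OrderDual.ofDual (g P) : Submodule R' V') from hgS P hP)
          (show (OrderDual.ofDual (g P) : Submodule R' V') ≤ U from hUg P hP)
        obtain ⟨Φ, hΦ⟩ := exists_annihilator_eq b
        exact ⟨Φ, by rw [hΦ, hb, OrderDual.toDual_ofDual]⟩
    refine ⟨S, U, hSU, by omega, by omega, σ, l, ⟨?_, ?_⟩, hlX⟩
    · have h1 := finrank_annihilator_add
        (⊤ : Submodule R'ᵐᵒᵖ (Module.Dual R' (Subquot S U)))
      obtain ⟨Φ, hΦ⟩ := exists_annihilator_eq (⊥ : Submodule R' (Subquot S U))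
      have h2 := finrank_annihilator_add Φ
      rw [hΦ, finrank_bot] at h2
      have h3 : finrank R'ᵐᵒᵖ Φ ≤ finrank R'ᵐᵒᵖ (Module.Dual R' (Subquot S U)) :=
        Submodule.finrank_le Φ
      omega
    · rwa [hn']

end Types

end GrassmannEmb

theorem theorem4p1 {R R' V V' : Type*} [DivisionRing R] [DivisionRing R']
    [AddCommGroup V] [Module R V] [FiniteDimensional R V]
    [AddCommGroup V'] [Module R' V'] [FiniteDimensional R' V']
    (n n' k k' : ℕ) (hn : Module.finrank R V = n) (hn' : Module.finrank R' V' = n')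
    (hk : 1 < k) (hkn : k + 1 < n) (hk' : 1 < k') (hkn' : k' + 1 < n')
    (h2k : k + k ≤ n)
    (f : GrassmannEmb.grassmannGraph R V k ↪g GrassmannEmb.grassmannGraph R' V' k')
    (hf : ∀ X Y : GrassmannEmb.Grass R V k,
      (GrassmannEmb.grassmannGraph R' V' k').dist (f X) (f Y) =
        (GrassmannEmb.grassmannGraph R V k).dist X Y) :
    ((∃ S : Submodule R' V', Module.finrank R' S + k = k' ∧
        ∃ (σ : R →+* R') (l : V →ₛₗ[σ] (V' ⧸ S)),
          GrassmannEmb.IsSemilinearMEmbedding (2 * k) l ∧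
          ∀ X : GrassmannEmb.Grass R V k,
            (f X).1 = (GrassmannEmb.spanImage l X.1).comap S.mkQ) ∨
      (∃ U : Submodule R' V', Module.finrank R' U = k' + k ∧
        ∃ (σ : R →+* R'ᵐᵒᵖ) (l : V →ₛₗ[σ] Module.Dual R' U),
          GrassmannEmb.IsSemilinearMEmbedding (2 * k) l ∧
          ∀ X : GrassmannEmb.Grass R V k,
            (f X).1 =
              (GrassmannEmb.annihilator (GrassmannEmb.spanImage l X.1)).map U.subtype)) ∧
    (n = 2 * k →
      ∃ S U : Submodule R' V', S ≤ U ∧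
        Module.finrank R' S + k = k' ∧ Module.finrank R' U = k' + k ∧
        ((∃ (σ : R →+* R') (l : V →ₛₗ[σ] GrassmannEmb.Subquot S U),
            GrassmannEmb.IsSemilinearEmbedding l ∧
            ∀ X : GrassmannEmb.Grass R V k,
              (f X).1 = GrassmannEmb.liftSubquot S U (GrassmannEmb.spanImage l X.1)) ∨
          (∃ (σ : R →+* R'ᵐᵒᵖ) (l : V →ₛₗ[σ] Module.Dual R' (GrassmannEmb.Subquot S U)),
            GrassmannEmb.IsSemilinearEmbedding l ∧
            ∀ X : GrassmannEmb.Grass R V k,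
              (f X).1 = GrassmannEmb.liftSubquot S U
                (GrassmannEmb.annihilator (GrassmannEmb.spanImage l X.1))))) := by
  classical
  -- The map on all subspaces that agrees with `f` on the `k`-dimensional ones.
  let F : Submodule R V → Submodule R' V' := fun X =>
    if h : Module.finrank R X = k then (f ⟨X, h⟩).1 else ⊥
  have hF : ∀ X : GrassmannEmb.Grass R V k, F X.1 = (f X).1 := fun X => dif_pos X.2
  have hFd : ∀ X : Submodule R V, Module.finrank R X = k → Module.finrank R' (F X) = k' :=
    fun X hX => by rw [hF ⟨X, hX⟩]; exact (f ⟨X, hX⟩).2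
  have hFi : ∀ X Y : Submodule R V, Module.finrank R X = k → Module.finrank R Y = k →
      Module.finrank R' ↥(F X ⊓ F Y) + k = k' + Module.finrank R ↥(X ⊓ Y) := by
    intro X Y hX hY
    have h1 := GrassmannEmb.finrank_inf_add_dist (⟨X, hX⟩ : GrassmannEmb.Grass R V k) ⟨Y, hY⟩
    have h2 := GrassmannEmb.finrank_inf_add_dist (f ⟨X, hX⟩) (f ⟨Y, hY⟩)
    rw [hf, ← hF, ← hF] at h2
    dsimp only at h1 h2
    omega
  -- Two `k`-dimensional subspaces with trivial intersection show `k ≤ k'` and `k' + k ≤ n'`.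
  obtain ⟨X₀, Y₀, -, -, hX₀, hY₀, hXY₀⟩ := GrassmannEmb.exists_extensions
    (A := (⊥ : Submodule R V)) (B := ⊥) (a := k) (b := k) (by rw [finrank_bot]; omega)
    (by rw [finrank_bot]; omega) (by omega)
  have h₀ := hFi X₀ Y₀ hX₀ hY₀
  rw [hXY₀, inf_idem, finrank_bot] at h₀
  have hs₀ := Submodule.finrank_sup_add_finrank_inf_eq (F X₀) (F Y₀)
  rw [hFd X₀ hX₀, hFd Y₀ hY₀] at hs₀
  have hle₀ := Submodule.finrank_le (F X₀ ⊔ F Y₀)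
  have hiso : GrassmannEmb.IsIsometricAt (fun X : Submodule R' V' => Module.finrank R' X)
      (k' - k) k F := fun X Y hX hY => by
    have := hFi X Y hX hY
    dsimp only
    omega
  rcases GrassmannEmb.forall_isStarAt_or_forall_isTopAt (GrassmannEmb.isRank_finrank R' V') hiso
    hk (by omega) with hstar | htop
  · obtain ⟨⟨S, hS, σ, l, hl, hlX⟩, h2⟩ :=
      GrassmannEmb.exists_semilinear_of_star hk (by omega) ⟨hiso, hstar⟩
    refine ⟨Or.inl ⟨S, by omega, σ, l, hl, fun X => by rw [← hF, hlX X.1 X.2]⟩, fun hnk => ?_⟩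
    obtain ⟨S, U, hSU, hS, hU, σ, l, hl, hlX⟩ := h2 (by omega)
    exact ⟨S, U, hSU, by omega, by omega,
      Or.inl ⟨σ, l, hl, fun X => by rw [← hF, hlX X.1 X.2]⟩⟩
  · have hdual : GrassmannEmb.IsStarIsometry (GrassmannEmb.codim R' V') (n' - k' - k) k
        (fun X => OrderDual.toDual (F X)) := by
      refine ⟨fun X Y hX hY => ?_, fun C hC => ?_⟩
      · have h1 := GrassmannEmb.codim_add (OrderDual.toDual (F X) ⊓ OrderDual.toDual (F Y))
        rw [← toDual_sup, OrderDual.ofDual_toDual] at h1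
        have h2 := Submodule.finrank_sup_add_finrank_inf_eq (F X) (F Y)
        rw [hFd X hX, hFd Y hY] at h2
        have h3 := hFi X Y hX hY
        rw [← toDual_sup]
        have h4 := Submodule.finrank_mono (inf_le_left : X ⊓ Y ≤ X)
        omega
      · obtain ⟨c, hc, hcA⟩ := htop C hC
        change Module.finrank R' c = k' - k + k + 1 at hc
        have h1 := GrassmannEmb.codim_add (OrderDual.toDual c)
        rw [OrderDual.ofDual_toDual] at h1
        exact ⟨OrderDual.toDual c, by omega, fun A hCA hA => hcA A hCA hA⟩
    obtain ⟨⟨U, hU, σ, l, hl, hlX⟩, h2⟩ :=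
      GrassmannEmb.exists_semilinear_of_costar hk (by omega) hdual
    refine ⟨Or.inr ⟨U, by omega, σ, l, hl, fun X => by rw [← hF, hlX X.1 X.2]⟩, fun hnk => ?_⟩
    obtain ⟨S, U, hSU, hU, hS, σ, l, hl, hlX⟩ := h2 (by omega)
    exact ⟨S, U, hSU, by omega, by omega,
      Or.inr ⟨σ, l, hl, fun X => by rw [← hF, hlX X.1 X.2]⟩⟩
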